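/- Let $\mathcal X,\mathcal Y$ be finite dimensional real Euclidean spaces, $\mathcal A:\mathcal X\to\mathcal Y$ linear with adjoint $\mathcal A^*$, $c\in\mathcal X$, $p:\mathcal X\to(-\infty,+\infty]$ closed proper convex, and $h:\mathcal Y\to\mathbb R$ such that (a) $h$ is convex and differentiable, and $\nabla h$ is $1/\alpha_h$-Lipschitz continuous for some $\alpha_h>0$; (b) $h$ is essentially locally strongly convex: for every compact convex $K\subset\operatorname{dom}\partial h$ there is $\beta_K>0$ with $(1-\lambda)h(y')+\lambda h(y)\ge h((1-\lambda)y'+\lambda y)+\tfrac12\beta_K\lambda(1-\lambda)\|y'-y\|^2$ for all $y',y\in K$, $\lambda\in[0,1]$. Let $f(x)=h(\mathcal Ax)-\langle c,x\rangle+p(x)$ and consider $$(\mathbf P)\ \ \max_x\,-f(x),\qquad (\mathbf D)\ \ \min_{y,z}\{h^*(y)+p^*(z)\mid \mathcal A^*y+z=c\},$$ where $^*$ on functions is the Fenchel conjugate. Let $\Omega$ be the solution set of $(\mathbf P)$. Put $l(y,z,x)=h^*(y)+p^*(z)-\langle x,\mathcal A^*y+z-c\rangle$, $\mathcal L_\sigma(y,z;x)=l(y,z,x)+\frac\sigma2\|\mathcal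 A^*y+z-c\|^2$, $\mathcal T_f(x)=\partial f(x)$ and $\mathcal T_l(y,z,x)=\{(y',z',x')\mid (y',z',-x')\in\partial l(y,z,x)\}$, where $\partial l$ is the subdifferential of the convex-concave function $l$ (subgradients in $(y,z)$, supergradients in $x$). Product spaces carry the Euclidean norm, and the distance to the empty set is $+\infty$. A multivalued mapping $F$ satisfies the error bound condition for $\bar y$ with modulus $\kappa\ge0$ if $F^{-1}(\bar y)\neq\emptyset$ and there is $\varepsilon>0$ such that $\operatorname{dist}(x,F^{-1}(\bar y))\le\kappa\operatorname{dist}(\bar y,F(x))$ whenever $\operatorname{dist}(\bar y,F(x))\le\varepsilon$. It is metrically subregular at $\bar x$ for $\bar y\in F(\bar x)$ with modulus $\kappa\ge0$ if there are neighborhoods $U$ of $\bar x$ and $V$ of $\bar y$ with $\operatorname{dist}(x,F^{-1}(\bar y))\le\kappa\operatorname{dist}(\bar y,F(x)\cap V)$ for all $x\in U$ with $F(x)\cap V\ne\emptyset$. Algorithm Ssnal (an inexact augmented Lagrangian method for $(\mathbf D)$): start from $(y^0,z^0,x^0)\in\operatorname{int}(\operatorname{dom}h^*)\times\operatorname{dom}p^*\times\mathcal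 X$. For $k=0,1,\dots$ let $(y^{k+1},z^{k+1})$ be an approximate minimizer of $\Psi_k(y,z):=\mathcal L_{\sigma_k}(y,z;x^k)$ and set $x^{k+1}=x^k-\sigma_k(\mathcal A^*y^{k+1}+z^{k+1}-c)$, where $\sigma_k>0$ is nondecreasing with limit $\sigma_\infty\le\infty$. The accuracy is controlled by the criteria (A) $\Psi_k(y^{k+1},z^{k+1})-\inf\Psi_k\le\varepsilon_k^2/(2\sigma_k)$, with $\varepsilon_k\ge0$, $\sum_k\varepsilon_k<\infty$; (B1) $\Psi_k(y^{k+1},z^{k+1})-\inf\Psi_k\le(\delta_k^2/(2\sigma_k))\|x^{k+1}-x^k\|^2$, with $\delta_k\ge0$, $\sum_k\delta_k<\infty$; (B2) $\operatorname{dist}(0,\partial\Psi_k(y^{k+1},z^{k+1}))\le(\delta_k'/\sigma_k)\|x^{k+1}-x^k\|$, with $0\le\delta'_k\to0$. **Theorem.** Assume that $\Omega\neq\emptyset$ and that $\mathcal T_f$ satisfies the error bound condition for the origin with modulus $a_f$. Let $\{(y^k,z^k,x^k)\}$ be any infinite sequence generated by Ssnal with stopping criteria (A) and (B1). Then $\{x^k\}$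 converges to some $x^*\in\Omega$, and for all sufficiently large $k$ $$\operatorname{dist}(x^{k+1},\Omega)\le\theta_k\operatorname{dist}(x^k,\Omega),$$ where $\theta_k=\bigl(a_f(a_f^2+\sigma_k^2)^{-1/2}+2\delta_k\bigr)(1-\delta_k)^{-1}\to\theta_\infty=a_f(a_f^2+\sigma_\infty^2)^{-1/2}<1$ (with $\theta_\infty=0$ if $\sigma_\infty=\infty$). Moreover, $(\mathbf D)$ has a unique optimal solution $(y^*,z^*)$, it lies in $\operatorname{int}(\operatorname{dom}h^*)\times\operatorname{dom}p^*$, and $(y^k,z^k)\to(y^*,z^*)$. If moreover $\mathcal T_l$ is metrically subregular at $(y^*,z^*,x^*)$ for the origin with modulus $a_l$ and criterion (B2) is also used, then for all sufficiently large $k$ $$\|(y^{k+1},z^{k+1})-(y^*,z^*)\|\le\theta_k'\|x^{k+1}-x^k\|,$$ where $\theta_k'=a_l(1+\delta_k')/\sigma_k\to a_l/\sigma_\infty$ (which is $0$ if $\sigma_\infty=\infty$). -/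

import Mathlib

open Set Filter Topology
open scoped ENNReal

noncomputable section

namespace Ssnal

/-! ### Extended-real-valued convex functions -/

section Convex

variable {E : Type*} [NormedAddCommGroup E] [InnerProductSpace ℝ E]

/-- The effective domain of `f : E → [-∞, ∞]`. -/
def dom (f : E → EReal) : Set E := {x | f x < ⊤}

/-- `f : E → (-∞, ∞]` is closed (lower semicontinuous), proper and convex (convex epigraph). -/
structure ClosedProperConvex (f : E → EReal) : Prop where
  ne_bot : ∀ x, f x ≠ ⊥
  dom_nonempty : (dom f).Nonempty
  closed : LowerSemicontinuous f
  convex : Convex ℝ {q : E × ℝ | f q.1 ≤ (q.2 : EReal)}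

/-- The Fenchel conjugate `f*(v) = sup_x {⟨v, x⟩ - f(x)}`. -/
def conj (f : E → EReal) (v : E) : EReal := ⨆ x, ((inner ℝ v x : ℝ) : EReal) - f x

/-- The subdifferential of convex analysis,
`∂f(x) = {v | f(u) ≥ f(x) + ⟨v, u - x⟩ for all u}`. -/
def subdiff (f : E → EReal) (x : E) : Set E :=
  {v | ∀ u, f x + ((inner ℝ v (u - x) : ℝ) : EReal) ≤ f u}

/-- The superdifferential of a concave function,
`{v | g(u) ≤ g(x) + ⟨v, u - x⟩ for all u}`. -/
def superdiff (g : E → EReal) (x : E) : Set E :=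
  {v | ∀ u, g u ≤ g x + ((inner ℝ v (u - x) : ℝ) : EReal)}

end Convex

/-! ### Multivalued mappings -/

section Multivalued

variable {E G : Type*} [PseudoMetricSpace E] [PseudoMetricSpace G]

/-- `F⁻¹(y) = {x | y ∈ F(x)}`. -/
def inv (F : E → Set G) (y : G) : Set E := {x | y ∈ F x}

/-- `F` satisfies the error bound condition for the point `y` with modulus `κ ≥ 0`.  The distance
to the empty set is `+∞`, so that points with `F(x) = ∅` are not restricted. -/
def ErrorBound (F : E → Set G) (y : G) (κ : ℝ) : Prop :=
  0 ≤ κ ∧ (inv F y).Nonempty ∧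
    ∃ ε : ℝ, 0 < ε ∧ ∀ x, (F x).Nonempty → Metric.infDist y (F x) ≤ ε →
      Metric.infDist x (inv F y) ≤ κ * Metric.infDist y (F x)

/-- `F` is metrically subregular at `xb` for `yb` with modulus `κ ≥ 0`.  The distance to the empty
set is `+∞`, so that points with `F(x) ∩ V = ∅` are not restricted. -/
def MetricallySubregular (F : E → Set G) (xb : E) (yb : G) (κ : ℝ) : Prop :=
  0 ≤ κ ∧ yb ∈ F xb ∧
    ∃ U ∈ 𝓝 xb, ∃ V ∈ 𝓝 yb, ∀ x ∈ U, (F x ∩ V).Nonempty →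
      Metric.infDist x (inv F yb) ≤ κ * Metric.infDist yb (F x ∩ V)

end Multivalued

/-! ### The composite problem, its dual, the Lagrangians and the operators -/

/-- The Euclidean product space `Y × X` of the dual variables `(y, z)`. -/
abbrev Dual (X Y : Type*) := WithLp 2 (Y × X)

/-- The Euclidean product space `Y × X × X` of the triples `(y, z, x)`. -/
abbrev Triple (X Y : Type*) := WithLp 2 (Dual X Y × X)

/-- The point `(y, z)`. -/
def pair {X Y : Type*} (y : Y) (z : X) : Dual X Y := WithLp.toLp 2 (y, z)

/-- The point `(y, z, x)`. -/
def triple {X Y : Type*} (y : Y) (z x : X) : Triple X Y := WithLp.toLp 2 (pair y z, x)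

/-- The data of the composite problem. -/
structure Data (X Y : Type*) [NormedAddCommGroup X] [InnerProductSpace ℝ X]
    [NormedAddCommGroup Y] [InnerProductSpace ℝ Y] where
  /-- the linear map -/
  A : X →ₗ[ℝ] Y
  /-- the linear term -/
  c : X
  /-- the real-valued loss function -/
  h : Y → ℝ
  /-- the extended-real-valued regularizer -/
  p : X → EReal

section Problem

variable {X Y : Type*} [NormedAddCommGroup X] [InnerProductSpace ℝ X] [FiniteDimensional ℝ X]
  [NormedAddCommGroup Y] [InnerProductSpace ℝ Y] [FiniteDimensional ℝ Y]

/-- The assumptions on `h` : (a) `h` is convex and differentiable and its gradient is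
`1/α`-Lipschitz; (b) `h` is essentially locally strongly convex. -/
structure SmoothLoss (h : Y → ℝ) (α : ℝ) : Prop where
  convex : ConvexOn ℝ univ h
  differentiable : Differentiable ℝ h
  modulus_pos : 0 < α
  lipschitz :
    haveI : CompleteSpace Y := FiniteDimensional.complete ℝ Y
    ∀ y' y : Y, ‖gradient h y' - gradient h y‖ ≤ (1 / α) * ‖y' - y‖
  locally_strong : ∀ K : Set Y, IsCompact K → Convex ℝ K →
    (∀ y ∈ K, (subdiff (fun u => (h u : EReal)) y).Nonempty) →
    ∃ β : ℝ, 0 < β ∧ ∀ y' ∈ K, ∀ y ∈ K, ∀ t ∈ Icc (0 : ℝ) 1,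
      h ((1 - t) • y' + t • y) + (1 / 2) * β * t * (1 - t) * ‖y' - y‖ ^ 2
        ≤ (1 - t) * h y' + t * h y

namespace Data

variable (D : Data X Y)

/-- `f(x) = h(A x) - ⟨c, x⟩ + p(x)`. -/
def f (x : X) : EReal := ((D.h (D.A x) - inner ℝ D.c x : ℝ) : EReal) + D.p x

/-- The solution set `Ω` of `(P) : max -f(x)`. -/
def primalSol : Set X := {x | IsMaxOn (fun u => -D.f u) univ x}

/-- `h*`. -/
def hConj : Y → EReal := conj (fun y => (D.h y : EReal))

/-- `p*`. -/
def pConj : X → EReal := conj D.p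

/-- The residual `A* y + z - c` of the constraint of the dual problem. -/
def resid (w : Dual X Y) : X := LinearMap.adjoint D.A w.fst + w.snd - D.c

/-- `h*(y) + p*(z)`. -/
def dualObj (w : Dual X Y) : EReal := D.hConj w.fst + D.pConj w.snd

/-- The solution set of `(D) : min {h*(y) + p*(z) | A* y + z = c}`. -/
def dualSol : Set (Dual X Y) :=
  {w | D.resid w = 0 ∧ IsMinOn D.dualObj {v | D.resid v = 0} w}

/-- The Lagrangian `l(y, z, x) = h*(y) + p*(z) - ⟨x, A* y + z - c⟩`. -/
def lagr (w : Dual X Y) (x : X) : EReal :=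
  D.dualObj w - ((inner ℝ x (D.resid w) : ℝ) : EReal)

/-- The augmented Lagrangian `L_σ(y, z; x) = l(y, z, x) + (σ/2) ‖A* y + z - c‖²`. -/
def augLagr (σ : ℝ) (w : Dual X Y) (x : X) : EReal :=
  D.lagr w x + ((σ / 2 * ‖D.resid w‖ ^ 2 : ℝ) : EReal)

/-- `T_f = ∂f`. -/
def Tf (x : X) : Set X := subdiff D.f x

/-- `T_l(y, z, x) = {(y', z', x') | (y', z', -x') ∈ ∂l(y, z, x)}`, where `∂l` is the
subdifferential of the convex-concave function `l` : subgradients in `(y, z)` paired with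
supergradients in `x`. -/
def Tl (u : Triple X Y) : Set (Triple X Y) :=
  {v | v.fst ∈ subdiff (fun w => D.lagr w u.snd) u.fst ∧
    -v.snd ∈ superdiff (fun x => D.lagr u.fst x) u.snd}

/-- `(y^k, z^k, x^k)` is a sequence of the inexact augmented Lagrangian method, up to the accuracy
of the inner minimizations (Step 1), which the stopping criteria below control :
the parameters are positive and increase to `σinf ≤ ∞`, the starting point is in
`int (dom h*) × dom p* × X`, and `x^{k+1} = x^k - σ_k (A* y^{k+1} + z^{k+1} - c)`. -/
structure IsALMSequence (σ : ℕ → ℝ) (σinf : ℝ≥0∞) (y : ℕ → Y) (z x : ℕ → X) : Prop where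
  pos : ∀ k, 0 < σ k
  mono : Monotone σ
  lim : Tendsto (fun k => ENNReal.ofReal (σ k)) atTop (𝓝 σinf)
  init_y : y 0 ∈ interior (dom D.hConj)
  init_z : z 0 ∈ dom D.pConj
  update : ∀ k, x (k + 1) = x k - σ k • D.resid (pair (y (k + 1)) (z (k + 1)))

/-- The function `Ψ_k(y, z) = L_{σ_k}(y, z; x^k)` of the `k`-th subproblem. -/
def Psi (σ : ℕ → ℝ) (x : ℕ → X) (k : ℕ) (w : Dual X Y) : EReal := D.augLagr (σ k) w (x k)

/-- Criterion (A). -/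
def CritA (σ : ℕ → ℝ) (y : ℕ → Y) (z x : ℕ → X) (ε : ℕ → ℝ) : Prop :=
  (∀ k, 0 ≤ ε k) ∧ Summable ε ∧
    ∀ k, D.Psi σ x k (pair (y (k + 1)) (z (k + 1))) - (⨅ w, D.Psi σ x k w) ≤
      ((ε k ^ 2 / (2 * σ k) : ℝ) : EReal)

/-- Criterion (B1). -/
def CritB1 (σ : ℕ → ℝ) (y : ℕ → Y) (z x : ℕ → X) (δ : ℕ → ℝ) : Prop :=
  (∀ k, 0 ≤ δ k) ∧ Summable δ ∧
    ∀ k, D.Psi σ x k (pair (y (k + 1)) (z (k + 1))) - (⨅ w, D.Psi σ x k w) ≤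
      ((δ k ^ 2 / (2 * σ k) * ‖x (k + 1) - x k‖ ^ 2 : ℝ) : EReal)

/-- Criterion (B2); the distance to the empty set is `+∞`, so the criterion includes that the
subdifferential is nonempty. -/
def CritB2 (σ : ℕ → ℝ) (y : ℕ → Y) (z x : ℕ → X) (δ' : ℕ → ℝ) : Prop :=
  (∀ k, 0 ≤ δ' k) ∧ Tendsto δ' atTop (𝓝 0) ∧
    ∀ k, (subdiff (D.Psi σ x k) (pair (y (k + 1)) (z (k + 1)))).Nonempty ∧
      Metric.infDist 0 (subdiff (D.Psi σ x k) (pair (y (k + 1)) (z (k + 1)))) ≤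
        δ' k / σ k * ‖x (k + 1) - x k‖

end Data

end Problem

/-! ### The rates -/

/-- `θ_k = (a_f (a_f² + σ_k²)^{-1/2} + 2 δ_k) (1 - δ_k)⁻¹`. -/
def theta (a s d : ℝ) : ℝ := (a / √(a ^ 2 + s ^ 2) + 2 * d) / (1 - d)

/-- `θ_∞ = a_f (a_f² + σ_∞²)^{-1/2}`, which is `0` if `σ_∞ = ∞`. -/
def thetaInf (a : ℝ) (sinf : ℝ≥0∞) : ℝ :=
  open Classical in if sinf = ⊤ then 0 else a / √(a ^ 2 + sinf.toReal ^ 2)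

/-- `θ'_k = a_l (1 + δ'_k) / σ_k`. -/
def theta' (a s d : ℝ) : ℝ := a * (1 + d) / s

/-- `a_l / σ_∞`, which is `0` if `σ_∞ = ∞`. -/
def thetaInf' (a : ℝ) (sinf : ℝ≥0∞) : ℝ :=
  open Classical in if sinf = ⊤ then 0 else a / sinf.toReal

end Ssnal

end

/-!
The method is an inexact proximal point method for `f` in disguise, seen through its dual.

Let `P` be the proximal point of `x` for the function `s f`. Its optimality condition
(`Ssnal.Data.IsProx`) says that `c - A* ∇h(A P) + (x - P)/s` is a subgradient of `p` at `P`. The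
pair formed by `∇h(A P)` and this subgradient (`Ssnal.Data.proxPair`) attains equality in both
Fenchel-Young inequalities, so the value of the augmented Lagrangian there is
`-f(P) - ‖x - P‖² / (2s)`. For an arbitrary `w = (y, z)` the Fenchel-Young inequalities at `A P`
and `P`, the first one sharpened because `h*` is strongly convex when `∇h` is Lipschitz, bound the
augmented Lagrangian from below by the same value plus
`‖x - s r(w) - P‖² / (2s) + (α/4) ‖y - ∇h(A P)‖²`, where `r(w)` is the residual of the constraint.
So an approximate minimizer gives a multiplier update close to `P`
(`Ssnal.Data.IsProx.sq_le_of_augLagr_sub_le`). No biconjugation is needed.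

The summable errors of the criterion `CritA` make the iterates quasi-Fejér monotone with respect
to the solution set, and the subgradients `(x - P)/σ` tend to `0`, so they converge to a solution
`x*` (`Ssnal.Data.tendsto_of_isProx`). The error bound, combined with
`‖P - u‖² + ‖x - P‖² ≤ ‖x - u‖²` for solutions `u`, contracts the distance to the solution set by
`a / √(a² + σ²)`, and `CritB1` costs the terms in `δ` (`Ssnal.Data.eventually_infDist_le`). The
same lower bound gives `y → ∇h(A x*)`, the constraint gives the limit of `z`
(`Ssnal.Data.tendsto_dual`), and the strong convexity of `h*` gives uniqueness of the dual
solution (`Ssnal.Data.dualSol_eq`). The local strong convexity of `h` near `A x*` makes `h` grow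
linearly above its tangent there, hence `∇h(A x*)` is interior to the domain of `h*`
(`Ssnal.SmoothLoss.lossGrad_mem_interior_dom`).

For the dual rate, a subgradient of the augmented Lagrangian at `w`, paired with the residual of
`w`, is a value of the operator of the Lagrangian at `w` and the updated multiplier
(`Ssnal.Data.mem_Tl_of_mem_subdiff_augLagr`); every zero of that operator has the dual solution as
its first part, so subregularity bounds the distance of `w` to it.
-/

namespace Ssnal

/-! ### Conjugates and subgradients through real numbers -/

section Convex

variable {E : Type*} [NormedAddCommGroup E] [InnerProductSpace ℝ E]

/-- Testing an upper bound by real numbers. -/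
theorem le_of_forall_real {a b : EReal} (h : ∀ r : ℝ, b ≤ r → a ≤ r) : a ≤ b := by
  induction b with
  | top => exact le_top
  | coe r => exact h r le_rfl
  | bot =>
    refine EReal.le_of_forall_lt_iff_le.1 fun r _ => h r bot_le

theorem conj_le_coe_iff {f : E → EReal} {v : E} {b : ℝ} :
    conj f v ≤ b ↔ ∀ x, ∀ a : ℝ, f x ≤ a → inner ℝ v x ≤ a + b := by
  unfold conj
  rw [iSup_le_iff]
  refine forall_congr' fun x => ⟨fun h a ha => ?_, fun h => ?_⟩
  · have h1 : ((inner ℝ v x : ℝ) : EReal) - (a : EReal) ≤ b :=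
      (EReal.sub_le_sub le_rfl ha).trans h
    have h2 : inner ℝ v x - a ≤ b := by exact_mod_cast h1
    linarith
  · induction hf : f x with
    | top => simp
    | coe a =>
      have := h a hf.le
      have h2 : inner ℝ v x - a ≤ b := by linarith
      exact_mod_cast h2
    | bot =>
      have := h (inner ℝ v x - b - 1) (by simp [hf])
      linarith

theorem conj_ne_bot {f : E → EReal} (hf : (dom f).Nonempty) (v : E) : conj f v ≠ ⊥ := by
  obtain ⟨x, hx⟩ := hf
  intro h
  obtain ⟨a, ha, -⟩ := EReal.lt_iff_exists_real_btwn.1 hx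
  have h1 := (conj_le_coe_iff (f := f) (v := v) (b := inner ℝ v x - a - 1)).1 (by simp [h])
    x a ha.le
  linarith

/-- The Fenchel-Young inequality. -/
theorem inner_le_of_conj_eq {f : E → EReal} {v x : E} {a b : ℝ} (hb : conj f v = b)
    (ha : f x = a) : inner ℝ v x ≤ a + b :=
  conj_le_coe_iff.1 hb.le x a ha.le

theorem mem_subdiff_iff {f : E → EReal} {x v : E} {a : ℝ} (ha : f x = a) :
    v ∈ subdiff f x ↔ ∀ u, ∀ b : ℝ, f u ≤ b → a + inner ℝ v (u - x) ≤ b := by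
  simp only [subdiff, mem_ofPred_eq, ha]
  refine forall_congr' fun u => ⟨fun h b hb => ?_, fun h => le_of_forall_real fun b hb => ?_⟩
  · exact_mod_cast h.trans hb
  · exact_mod_cast h b hb

/-- Equality in the Fenchel-Young inequality at a subgradient. -/
theorem conj_eq_of_mem_subdiff {f : E → EReal} {x v : E} {a : ℝ} (ha : f x = a)
    (hv : v ∈ subdiff f x) : conj f v = ((inner ℝ v x - a : ℝ) : EReal) := by
  refine le_antisymm (conj_le_coe_iff.2 fun u b hb => ?_) ?_
  · have := (mem_subdiff_iff ha).1 hv u b hb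
    rw [inner_sub_right] at this
    linarith
  · refine le_of_forall_real fun b hb => ?_
    have := conj_le_coe_iff.1 hb x a ha.le
    exact_mod_cast (by linarith : inner ℝ v x - a ≤ b)

/-- A subgradient exists only where the function is finite. -/
theorem exists_real_of_mem_subdiff {f : E → EReal} {x v : E} (hbot : ∀ u, f u ≠ ⊥)
    (hdom : (dom f).Nonempty) (hv : v ∈ subdiff f x) : ∃ a : ℝ, f x = a := by
  induction hf : f x with
  | top =>
    obtain ⟨u, hu⟩ := hdom
    have := hv u
    rw [hf, EReal.top_add_coe, top_le_iff] at this
    exact absurd this hu.ne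
  | coe a => exact ⟨a, rfl⟩
  | bot => exact absurd hf (hbot x)

theorem convex_epigraph_conj (f : E → EReal) :
    Convex ℝ {q : E × ℝ | conj f q.1 ≤ (q.2 : EReal)} := by
  rintro ⟨v, b⟩ hv ⟨w, c⟩ hw s t hs ht hst
  simp only [mem_ofPred_eq, conj_le_coe_iff] at hv hw
  change conj f (s • v + t • w) ≤ ((s * b + t * c : ℝ) : EReal)
  refine conj_le_coe_iff.2 fun x a ha => ?_
  have h1 := mul_le_mul_of_nonneg_left (hv x a ha) hs
  have h2 := mul_le_mul_of_nonneg_left (hw x a ha) ht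
  rw [inner_add_left, real_inner_smul_left, real_inner_smul_left]
  have : a = s * a + t * a := by rw [← add_mul, hst, one_mul]
  linarith

/-- The sum rule for a convex function `φ` and a differentiable function `q`, in the direction
`∂(φ + q)(x) ⊆ ∂φ(x) + ∇q(x)`. -/
theorem sub_mem_subdiff_of_mem_subdiff_add {φ : E → EReal} {q : E → ℝ} {x g v : E} {a : ℝ}
    (hφ : Convex ℝ {p : E × ℝ | φ p.1 ≤ (p.2 : EReal)}) (ha : φ x = a)
    (hq : HasFDerivAt q (innerSL ℝ g) x)
    (hv : v ∈ subdiff (fun u => φ u + ((q u : ℝ) : EReal)) x) : v - g ∈ subdiff φ x := by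
  have hax : (fun u => φ u + ((q u : ℝ) : EReal)) x = ((a + q x : ℝ) : EReal) := by
    simp [ha]
  replace hv := (mem_subdiff_iff (f := fun u => φ u + ((q u : ℝ) : EReal)) hax).1 hv
  refine (mem_subdiff_iff ha).2 fun u b hb => ?_
  have hline : HasDerivAt (fun t : ℝ => q (x + t • (u - x))) (inner ℝ g (u - x)) 0 := by
    have h1 : HasDerivAt (fun t : ℝ => x + t • (u - x)) (u - x) 0 := by
      simpa using ((hasDerivAt_id (0 : ℝ)).smul_const (u - x)).const_add x
    have h2 : HasFDerivAt q (innerSL ℝ g) (x + (0 : ℝ) • (u - x)) := by simpa using hq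
    exact h2.comp_hasDerivAt (0 : ℝ) h1
  have hlim := hline.tendsto_slope_zero_right
  have key : a - b + inner ℝ v (u - x) ≤ inner ℝ g (u - x) := by
    refine ge_of_tendsto hlim ?_
    filter_upwards [Ioo_mem_nhdsGT (zero_lt_one (α := ℝ))] with t ht
    have hconv : φ (x + t • (u - x)) ≤ (((1 - t) * a + t * b : ℝ) : EReal) := by
      have := hφ (x := (x, a)) (by simp [ha]) (y := (u, b)) (by simpa using hb)
        (sub_nonneg.2 ht.2.le) ht.1.le (by ring)
      have he : x + t • (u - x) = (1 - t) • x + t • u := by module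
      rw [he]
      simpa using this
    have h1 := hv (x + t • (u - x)) ((1 - t) * a + t * b + q (x + t • (u - x)))
      (by push_cast at hconv ⊢; exact add_le_add_left hconv _)
    rw [add_sub_cancel_left, real_inner_smul_right] at h1
    simp only [zero_add, zero_smul, add_zero, smul_eq_mul]
    rw [inv_mul_eq_div, le_div_iff₀ ht.1]
    nlinarith
  rw [inner_sub_left]
  linarith

/-- The proximal point of a lower semicontinuous function that attains its minimum. -/
theorem exists_isMinOn_add_sq [FiniteDimensional ℝ E] {F : E → EReal} (hF : LowerSemicontinuous F)
    {xb : E} (hmin : ∀ u, F xb ≤ F u) {s : ℝ} (hs : 0 ≤ s) (x : E) :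
    ∃ P, ∀ u, F P + ((s * ‖P - x‖ ^ 2 : ℝ) : EReal) ≤ F u + ((s * ‖u - x‖ ^ 2 : ℝ) : EReal) := by
  have : ProperSpace E := FiniteDimensional.proper ℝ E
  have hq : LowerSemicontinuous fun u => ((s * ‖u - x‖ ^ 2 : ℝ) : EReal) :=
    Continuous.lowerSemicontinuous
      (continuous_coe_real_ereal.comp (by fun_prop : Continuous fun u : E => s * ‖u - x‖ ^ 2))
  have hG : LowerSemicontinuous fun u => F u + ((s * ‖u - x‖ ^ 2 : ℝ) : EReal) :=
    hF.add' hq fun u => EReal.continuousAt_add (Or.inr (EReal.coe_ne_bot _))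
      (Or.inr (EReal.coe_ne_top _))
  obtain ⟨P, -, hP⟩ := LowerSemicontinuousOn.exists_isMinOn
    (⟨xb, by simp [dist_eq_norm]⟩ : (Metric.closedBall x ‖xb - x‖).Nonempty)
    (isCompact_closedBall x ‖xb - x‖) (hG.lowerSemicontinuousOn _)
  refine ⟨P, fun u => ?_⟩
  by_cases hu : u ∈ Metric.closedBall x ‖xb - x‖
  · exact hP hu
  · have hxb : xb ∈ Metric.closedBall x ‖xb - x‖ := by simp [dist_eq_norm]
    refine (hP hxb).trans (add_le_add (hmin u) ?_)
    rw [Metric.mem_closedBall, dist_eq_norm, not_le] at hu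
    exact_mod_cast mul_le_mul_of_nonneg_left (pow_le_pow_left₀ (norm_nonneg _) hu.le 2) hs

end Convex

/-! ### The smooth loss -/

section Loss

variable {Y : Type*} [NormedAddCommGroup Y] [InnerProductSpace ℝ Y] [FiniteDimensional ℝ Y]

/-- The gradient of a function on a finite-dimensional space, whose completeness is supplied
here. -/
noncomputable def lossGrad (h : Y → ℝ) (u : Y) : Y :=
  haveI : CompleteSpace Y := FiniteDimensional.complete ℝ Y
  gradient h u

variable {h : Y → ℝ} {α : ℝ}

theorem SmoothLoss.hasFDerivAt (hh : SmoothLoss h α) (u : Y) :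
    HasFDerivAt h (innerSL ℝ (lossGrad h u)) u := by
  have : CompleteSpace Y := FiniteDimensional.complete ℝ Y
  exact (hh.differentiable u).hasGradientAt.hasFDerivAt

theorem SmoothLoss.norm_lossGrad_sub_le (hh : SmoothLoss h α) (u v : Y) :
    ‖lossGrad h u - lossGrad h v‖ ≤ (1 / α) * ‖u - v‖ := hh.lipschitz u v

theorem SmoothLoss.continuous_lossGrad (hh : SmoothLoss h α) : Continuous (lossGrad h) := by
  have : LipschitzWith (Real.toNNReal (1 / α)) (lossGrad h) :=
    LipschitzWith.of_dist_le_mul fun u v => by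
      rw [dist_eq_norm, dist_eq_norm, Real.coe_toNNReal _ (one_div_pos.2 hh.modulus_pos).le]
      exact hh.norm_lossGrad_sub_le u v
  exact this.continuous

theorem SmoothLoss.convex_epigraph (hh : SmoothLoss h α) :
    Convex ℝ {q : Y × ℝ | ((h q.1 : ℝ) : EReal) ≤ (q.2 : EReal)} := by
  simpa using hh.convex.convex_epigraph

theorem SmoothLoss.lossGrad_mem_subdiff (hh : SmoothLoss h α) (u : Y) :
    lossGrad h u ∈ subdiff (fun v => (h v : EReal)) u := by
  -- The sum rule for `h + (-h) = 0`.
  have := sub_mem_subdiff_of_mem_subdiff_add (φ := fun v => (h v : EReal))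
    (q := fun v => -h v) (g := -lossGrad h u) (v := 0)
    hh.convex_epigraph rfl (by simpa using (hh.hasFDerivAt u).fun_neg) (by
      have h0 : ∀ v, (h v : EReal) + ((-h v : ℝ) : EReal) = 0 := fun v => by
        rw [← EReal.coe_add, add_neg_cancel, EReal.coe_zero]
      intro w
      simp only [inner_zero_left, h0, EReal.coe_zero, add_zero, le_refl])
  simpa using this

theorem SmoothLoss.gradient_inequality (hh : SmoothLoss h α) (u v : Y) :
    h u + inner ℝ (lossGrad h u) (v - u) ≤ h v :=
  (mem_subdiff_iff (f := fun v => (h v : EReal)) rfl).1 (hh.lossGrad_mem_subdiff u) v _ le_rfl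

/-- The Fenchel-Young gap of `h` controls the distance to the gradient: the conjugate of a function
with a Lipschitz continuous gradient is strongly convex.  The constant is not the best one. -/
theorem SmoothLoss.sq_le_conj_gap (hh : SmoothLoss h α) {y : Y} {b : ℝ}
    (hb : conj (fun u => (h u : EReal)) y = b) (u : Y) :
    α / 4 * ‖y - lossGrad h u‖ ^ 2 ≤ b + h u - inner ℝ y u := by
  have hα := hh.modulus_pos
  set g := lossGrad h u with hg
  -- The Fenchel-Young inequality is used at `w`, a step from `u` in the direction of the excess.
  set w := u + (α / 2) • (y - g) with hw
  have hwu : w - u = (α / 2) • (y - g) := by simp [hw]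
  have h1 : inner ℝ y w ≤ h w + b := inner_le_of_conj_eq (f := fun u => (h u : EReal)) hb rfl
  have h2 := hh.gradient_inequality w u
  have h3 : inner ℝ (lossGrad h w - g) (w - u) ≤ 1 / α * ‖w - u‖ * ‖w - u‖ :=
    (real_inner_le_norm _ _).trans
      (mul_le_mul_of_nonneg_right (hh.norm_lossGrad_sub_le w u) (norm_nonneg _))
  have h4 : inner ℝ (y - g) (w - u) = α / 2 * ‖y - g‖ ^ 2 := by
    rw [hwu, real_inner_smul_right, real_inner_self_eq_norm_sq]
  have h5 : 1 / α * ‖w - u‖ * ‖w - u‖ = α / 4 * ‖y - g‖ ^ 2 := by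
    rw [hwu, norm_smul, Real.norm_of_nonneg (by positivity)]
    field_simp
    ring
  have h6 : inner ℝ y w = inner ℝ y u + inner ℝ y (w - u) := by
    rw [← inner_add_right, add_sub_cancel]
  have h7 : inner ℝ (lossGrad h w) (u - w) = - inner ℝ (lossGrad h w) (w - u) := by
    rw [← inner_neg_right, neg_sub]
  rw [inner_sub_left] at h3 h4
  linarith

theorem SmoothLoss.hConj_lossGrad (hh : SmoothLoss h α) (u : Y) :
    conj (fun u => (h u : EReal)) (lossGrad h u)
      = ((inner ℝ (lossGrad h u) u - h u : ℝ) : EReal) :=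
  conj_eq_of_mem_subdiff rfl (hh.lossGrad_mem_subdiff u)

/-- Strong convexity of `h` around `u` makes `h` grow at least linearly with a positive slope above
its tangent at `u`, so that slightly tilted tangents are still minorants up to a constant. -/
theorem SmoothLoss.lossGrad_mem_interior_dom (hh : SmoothLoss h α) (u : Y) :
    lossGrad h u ∈ interior (dom (conj (fun u => (h u : EReal)))) := by
  have : ProperSpace Y := FiniteDimensional.proper ℝ Y
  obtain ⟨β, hβ, hstrong⟩ := hh.locally_strong (Metric.closedBall u 1) (isCompact_closedBall u 1)
    (convex_closedBall u 1) fun y _ => ⟨_, hh.lossGrad_mem_subdiff y⟩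
  set g := lossGrad h u with hg
  have hball : ∀ w, ‖w - u‖ ≤ 1 → h u + inner ℝ g (w - u) + β / 4 * ‖w - u‖ ^ 2 ≤ h w := by
    intro w hw
    have h1 := hstrong u (by simp) w (by simpa [dist_eq_norm] using hw) (1 / 2) (by norm_num)
    have h2 := hh.gradient_inequality u ((1 - 1 / 2 : ℝ) • u + (1 / 2 : ℝ) • w)
    have h3 : (1 - 1 / 2 : ℝ) • u + (1 / 2 : ℝ) • w - u = (1 / 2 : ℝ) • (w - u) := by module
    rw [h3, real_inner_smul_right, ← hg] at h2
    rw [norm_sub_rev] at h1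
    linarith
  have hout : ∀ w, 1 < ‖w - u‖ → h u + inner ℝ g (w - u) + β / 4 * ‖w - u‖ ≤ h w := by
    intro w hw
    have hd : 0 < ‖w - u‖ := zero_lt_one.trans hw
    set s := ‖w - u‖⁻¹ with hs
    have hs0 : 0 < s := inv_pos.2 hd
    have hs1 : s ≤ 1 := inv_le_one_of_one_le₀ hw.le
    have hsd : s * ‖w - u‖ = 1 := inv_mul_cancel₀ hd.ne'
    have he : u + s • (w - u) - u = s • (w - u) := by simp
    have hn : ‖u + s • (w - u) - u‖ = 1 := by
      rw [he, norm_smul, Real.norm_of_nonneg hs0.le, hsd]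
    have h1 := hball (u + s • (w - u)) hn.le
    rw [hn, he, real_inner_smul_right] at h1
    have h2 := hh.convex.2 (mem_univ u) (mem_univ w) (sub_nonneg.2 hs1) hs0.le (by ring)
    have h3 : (1 - s) • u + s • w = u + s • (w - u) := by module
    rw [h3, smul_eq_mul, smul_eq_mul] at h2
    have h4 : s * (h u + inner ℝ g (w - u) + β / 4 * ‖w - u‖) ≤ s * h w := by
      have : s * (β / 4 * ‖w - u‖) = β / 4 := by
        rw [mul_left_comm, hsd, mul_one]
      linarith
    exact le_of_mul_le_mul_left h4 hs0
  refine mem_interior.2 ⟨Metric.ball g (β / 4), fun v hv => ?_, Metric.isOpen_ball,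
    Metric.mem_ball_self (by positivity)⟩
  rw [Metric.mem_ball, dist_eq_norm] at hv
  refine lt_of_le_of_lt (b := ((inner ℝ v u - h u + β / 4 : ℝ) : EReal))
    (conj_le_coe_iff.2 fun w a ha => ?_) (EReal.coe_lt_top _)
  have ha' : h w ≤ a := by exact_mod_cast ha
  have h1 : inner ℝ v w = inner ℝ v u + inner ℝ g (w - u) + inner ℝ (v - g) (w - u) := by
    simp only [inner_sub_left, inner_sub_right]
    ring
  have h2 : inner ℝ (v - g) (w - u) ≤ β / 4 * ‖w - u‖ :=
    (real_inner_le_norm _ _).trans (mul_le_mul_of_nonneg_right hv.le (norm_nonneg _))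
  rcases le_or_gt ‖w - u‖ 1 with hw | hw
  · have h3 := hball w hw
    nlinarith [sq_nonneg ‖w - u‖]
  · have h3 := hout w hw
    linarith

end Loss

namespace Data

section Values

variable {X Y : Type*} [NormedAddCommGroup X] [InnerProductSpace ℝ X]
  [NormedAddCommGroup Y] [InnerProductSpace ℝ Y] {D : Data X Y}

/-! ### Values of the objective functions -/

theorem f_ne_bot (hp : ClosedProperConvex D.p) (x : X) : D.f x ≠ ⊥ :=
  EReal.add_ne_bot_iff.2 ⟨EReal.coe_ne_bot _, hp.ne_bot x⟩

theorem f_eq_coe {P : X} {a : ℝ} (ha : D.p P = a) :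
    D.f P = ((D.h (D.A P) - inner ℝ D.c P + a : ℝ) : EReal) := by
  simp [f, ha]

theorem mem_primalSol_iff {x : X} : x ∈ D.primalSol ↔ ∀ u, D.f x ≤ D.f u := by
  simp [primalSol, isMaxOn_iff, EReal.neg_le_neg_iff]

theorem inv_Tf_zero : inv D.Tf 0 = D.primalSol := by
  ext x
  simp [inv, Tf, subdiff, mem_primalSol_iff]

/-- The primal optimal value is finite. -/
theorem exists_f_eq_of_mem_primalSol (hp : ClosedProperConvex D.p) {x : X}
    (hx : x ∈ D.primalSol) : ∃ m : ℝ, D.f x = m := by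
  obtain ⟨u, hu⟩ := hp.dom_nonempty
  have h1 : D.f x < ⊤ := (mem_primalSol_iff.1 hx u).trans_lt
    (EReal.add_lt_top (EReal.coe_ne_top _) hu.ne)
  exact ⟨_, (EReal.coe_toReal h1.ne (f_ne_bot hp x)).symm⟩

theorem hConj_ne_bot (D : Data X Y) (y : Y) : D.hConj y ≠ ⊥ :=
  conj_ne_bot (f := fun y => (D.h y : EReal)) ⟨0, EReal.coe_lt_top _⟩ y

theorem pConj_ne_bot (hp : ClosedProperConvex D.p) (z : X) : D.pConj z ≠ ⊥ :=
  conj_ne_bot hp.dom_nonempty z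

theorem exists_coe_of_dualObj_ne_top (hp : ClosedProperConvex D.p) {w : Dual X Y}
    (hw : D.dualObj w ≠ ⊤) : ∃ b₁ b₂ : ℝ, D.hConj w.fst = b₁ ∧ D.pConj w.snd = b₂ := by
  have h1 : D.hConj w.fst ≠ ⊤ := fun h => hw (by
    rw [dualObj, h, EReal.top_add_of_ne_bot (pConj_ne_bot hp _)])
  have h2 : D.pConj w.snd ≠ ⊤ := fun h => hw (by
    rw [dualObj, h, EReal.add_top_of_ne_bot (D.hConj_ne_bot _)])
  exact ⟨_, _, (EReal.coe_toReal h1 (D.hConj_ne_bot _)).symm,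
    (EReal.coe_toReal h2 (pConj_ne_bot hp _)).symm⟩

theorem dualObj_eq_coe {w : Dual X Y} {b₁ b₂ : ℝ} (h1 : D.hConj w.fst = b₁)
    (h2 : D.pConj w.snd = b₂) : D.dualObj w = ((b₁ + b₂ : ℝ) : EReal) := by
  simp [dualObj, h1, h2]

theorem convex_epigraph_dualObj (hp : ClosedProperConvex D.p) :
    Convex ℝ {q : Dual X Y × ℝ | D.dualObj q.1 ≤ (q.2 : EReal)} := by
  rintro ⟨v, b⟩ hv ⟨w, c⟩ hw s t hs ht hst
  change D.dualObj v ≤ (b : EReal) at hv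
  change D.dualObj w ≤ (c : EReal) at hw
  change D.dualObj (s • v + t • w) ≤ ((s * b + t * c : ℝ) : EReal)
  obtain ⟨b₁, b₂, hb₁, hb₂⟩ := exists_coe_of_dualObj_ne_top hp
    (hv.trans_lt (EReal.coe_lt_top b)).ne
  obtain ⟨c₁, c₂, hc₁, hc₂⟩ := exists_coe_of_dualObj_ne_top hp
    (hw.trans_lt (EReal.coe_lt_top c)).ne
  rw [dualObj_eq_coe hb₁ hb₂, EReal.coe_le_coe_iff] at hv
  rw [dualObj_eq_coe hc₁ hc₂, EReal.coe_le_coe_iff] at hw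
  have h1 : D.hConj (s • v + t • w).fst ≤ ((s * b₁ + t * c₁ : ℝ) : EReal) :=
    convex_epigraph_conj (fun y => (D.h y : EReal)) (x := (v.fst, b₁)) hb₁.le
      (y := (w.fst, c₁)) hc₁.le hs ht hst
  have h2 : D.pConj (s • v + t • w).snd ≤ ((s * b₂ + t * c₂ : ℝ) : EReal) :=
    convex_epigraph_conj D.p (x := (v.snd, b₂)) hb₂.le (y := (w.snd, c₂)) hc₂.le hs ht hst
  refine (add_le_add h1 h2).trans ?_
  rw [← EReal.coe_add, EReal.coe_le_coe_iff]
  nlinarith [mul_le_mul_of_nonneg_left hv hs, mul_le_mul_of_nonneg_left hw ht]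

end Values

variable {X Y : Type*} [NormedAddCommGroup X] [InnerProductSpace ℝ X] [FiniteDimensional ℝ X]
  [NormedAddCommGroup Y] [InnerProductSpace ℝ Y] [FiniteDimensional ℝ Y]
variable {D : Data X Y} {α : ℝ}

/-! ### The primal problem and its proximal points -/

/-- The vector `c - A* ∇h(A P) + (x - P)/s` that the optimality condition of the proximal point
`P` of `x` requires to be a subgradient of `p` at `P`. -/
noncomputable def proxDual (D : Data X Y) (s : ℝ) (x P : X) : X :=
  D.c - LinearMap.adjoint D.A (lossGrad D.h (D.A P)) + (1 / s) • (x - P)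

/-- `P` is the proximal point of `x` for the function `s f`, expressed by the optimality condition
`0 ∈ A* ∇h(A P) - c + ∂p(P) + (P - x)/s`. -/
def IsProx (D : Data X Y) (s : ℝ) (x P : X) : Prop := D.proxDual s x P ∈ subdiff D.p P

theorem hasFDerivAt_smooth (hh : SmoothLoss D.h α) (s : ℝ) (x P : X) :
    HasFDerivAt (fun u => D.h (D.A u) - inner ℝ D.c u + 1 / (2 * s) * ‖u - x‖ ^ 2)
      (innerSL ℝ (-D.proxDual s x P)) P := by
  have hA : HasFDerivAt (fun u => D.A u) (LinearMap.toContinuousLinearMap D.A) P :=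
    (LinearMap.toContinuousLinearMap D.A).hasFDerivAt
  have h1 := (hh.hasFDerivAt (D.A P)).comp P hA
  have h2 : HasFDerivAt (fun u => inner ℝ D.c u) (innerSL ℝ D.c) P := (innerSL ℝ D.c).hasFDerivAt
  have h3 : HasFDerivAt (fun u => ‖u - x‖ ^ 2) _ P := ((hasFDerivAt_id P).sub_const x).norm_sq
  refine ((h1.sub h2).add (h3.const_mul (1 / (2 * s)))).congr_fderiv ?_
  ext v
  simp only [proxDual, add_apply, sub_apply,
    ContinuousLinearMap.comp_apply, smul_apply, innerSL_apply_apply,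
    LinearMap.coe_toContinuousLinearMap', inner_neg_left, inner_add_left, inner_sub_left,
    real_inner_smul_left, LinearMap.adjoint_inner_left, id, smul_eq_mul,
    ContinuousLinearMap.coe_id', nsmul_eq_mul, Nat.cast_ofNat]
  by_cases hs : s = 0
  · simp [hs]
  · field_simp
    ring

theorem lowerSemicontinuous_f (hh : SmoothLoss D.h α) (hp : ClosedProperConvex D.p) :
    LowerSemicontinuous D.f := by
  have hA : Continuous D.A := D.A.continuous_of_finiteDimensional
  have hc : Continuous fun x => D.h (D.A x) - inner ℝ D.c x :=
    (hh.differentiable.continuous.comp hA).sub (by fun_prop)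
  exact (continuous_coe_real_ereal.comp hc).lowerSemicontinuous.add' hp.closed fun x =>
    EReal.continuousAt_add (Or.inl (EReal.coe_ne_top _)) (Or.inl (EReal.coe_ne_bot _))

theorem exists_isProx (hh : SmoothLoss D.h α) (hp : ClosedProperConvex D.p)
    (hΩ : D.primalSol.Nonempty) {s : ℝ} (hs : 0 < s) (x : X) : ∃ P, D.IsProx s x P := by
  obtain ⟨xb, hxb⟩ := hΩ
  obtain ⟨m, hm⟩ := exists_f_eq_of_mem_primalSol hp hxb
  obtain ⟨P, hP⟩ := exists_isMinOn_add_sq (lowerSemicontinuous_f hh hp) (mem_primalSol_iff.1 hxb)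
    (by positivity : 0 ≤ 1 / (2 * s)) x
  refine ⟨P, ?_⟩
  have hsum : ∀ u, D.f u + ((1 / (2 * s) * ‖u - x‖ ^ 2 : ℝ) : EReal) = D.p u +
      ((D.h (D.A u) - inner ℝ D.c u + 1 / (2 * s) * ‖u - x‖ ^ 2 : ℝ) : EReal) := by
    intro u
    rw [f, EReal.coe_add (D.h (D.A u) - inner ℝ D.c u)]
    abel
  have h0 : (0 : X) ∈ subdiff (fun u => D.p u +
      ((D.h (D.A u) - inner ℝ D.c u + 1 / (2 * s) * ‖u - x‖ ^ 2 : ℝ) : EReal)) P := by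
    intro u
    simpa only [inner_zero_left, EReal.coe_zero, add_zero, ← hsum] using hP u
  obtain ⟨a, ha⟩ : ∃ a : ℝ, D.p P = a := by
    have h1 : D.p P ≠ ⊤ := by
      intro h
      have h2 := hP xb
      rw [hsum P, h, EReal.top_add_coe, top_le_iff, hm] at h2
      exact EReal.coe_ne_top _ (by exact_mod_cast h2)
    exact ⟨_, (EReal.coe_toReal h1 (hp.ne_bot P)).symm⟩
  simpa [IsProx] using
    sub_mem_subdiff_of_mem_subdiff_add hp.convex ha (hasFDerivAt_smooth hh s x P) h0

variable {s : ℝ} {x P : X}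

theorem IsProx.exists_p_eq (hp : ClosedProperConvex D.p) (hP : D.IsProx s x P) :
    ∃ a : ℝ, D.p P = a :=
  exists_real_of_mem_subdiff hp.ne_bot hp.dom_nonempty hP

theorem IsProx.mem_Tf (hh : SmoothLoss D.h α) (hp : ClosedProperConvex D.p)
    (hP : D.IsProx s x P) : (1 / s) • (x - P) ∈ D.Tf P := by
  obtain ⟨a, ha⟩ := hP.exists_p_eq hp
  refine (mem_subdiff_iff (f_eq_coe ha)).2 fun u b hb => ?_
  have hu : D.p u ≤ ((b - (D.h (D.A u) - inner ℝ D.c u) : ℝ) : EReal) := by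
    rw [EReal.coe_sub b]
    exact EReal.le_sub_iff_add_le (Or.inl (EReal.coe_ne_bot _)) (Or.inl (EReal.coe_ne_top _)) |>.2
      (by rwa [add_comm])
  have h1 := (mem_subdiff_iff ha).1 hP u _ hu
  have h2 := hh.gradient_inequality (D.A P) (D.A u)
  rw [← map_sub, ← LinearMap.adjoint_inner_left] at h2
  rw [proxDual, inner_add_left, inner_sub_left, inner_sub_right D.c] at h1
  linarith

/-- The inequality behind the firm nonexpansiveness of the proximal mapping, at a fixed point. -/
theorem IsProx.sq_add_sq_le (hh : SmoothLoss D.h α) (hp : ClosedProperConvex D.p) (hs : 0 < s)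
    (hP : D.IsProx s x P) {xb : X} (hxb : xb ∈ D.primalSol) :
    ‖P - xb‖ ^ 2 + ‖x - P‖ ^ 2 ≤ ‖x - xb‖ ^ 2 := by
  obtain ⟨a, ha⟩ := hP.exists_p_eq hp
  have h1 := (mem_subdiff_iff (f_eq_coe ha)).1 (hP.mem_Tf hh hp) xb _
    ((mem_primalSol_iff.1 hxb P).trans (f_eq_coe ha).le)
  rw [real_inner_smul_left] at h1
  have h2 : inner ℝ (x - P) (xb - P) ≤ 0 := by
    by_contra! h
    have : 0 < 1 / s * inner ℝ (x - P) (xb - P) := by positivity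
    linarith
  have h3 : x - xb = (x - P) - (xb - P) := by abel
  rw [h3, norm_sub_sq_real (x - P), norm_sub_rev P xb]
  linarith

theorem IsProx.eq_of_mem_primalSol (hh : SmoothLoss D.h α) (hp : ClosedProperConvex D.p)
    (hs : 0 < s) (hP : D.IsProx s x P) (hx : x ∈ D.primalSol) : P = x := by
  have h := hP.sq_add_sq_le hh hp hs hx
  rw [sub_self, norm_zero] at h
  exact sub_eq_zero.1 (norm_eq_zero.1 (by nlinarith [sq_nonneg ‖P - x‖, sq_nonneg ‖x - P‖]))

/-- A primal solution is its own proximal point, which is the Karush-Kuhn-Tucker condition; the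
parameter `1` plays no role, as the term `(x - x)/s` vanishes. -/
theorem isProx_self (hh : SmoothLoss D.h α) (hp : ClosedProperConvex D.p)
    (hx : x ∈ D.primalSol) : D.IsProx 1 x x := by
  obtain ⟨P, hP⟩ := exists_isProx hh hp ⟨x, hx⟩ one_pos x
  rwa [hP.eq_of_mem_primalSol hh hp one_pos hx] at hP

theorem IsProx.norm_sub_le (hh : SmoothLoss D.h α) (hp : ClosedProperConvex D.p) (hs : 0 < s)
    (hP : D.IsProx s x P) {xb : X} (hxb : xb ∈ D.primalSol) : ‖P - xb‖ ≤ ‖x - xb‖ :=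
  (sq_le_sq₀ (norm_nonneg _) (norm_nonneg _)).1
    (by nlinarith [hP.sq_add_sq_le hh hp hs hxb, sq_nonneg ‖x - P‖])

/-- The proximal step turns the error bound into a contraction of the distance to the solution
set. -/
theorem IsProx.infDist_le (hh : SmoothLoss D.h α) (hp : ClosedProperConvex D.p) (hs : 0 < s)
    (hP : D.IsProx s x P) (hΩ : D.primalSol.Nonempty) {a : ℝ} (ha : 0 ≤ a)
    (hbound : Metric.infDist P D.primalSol ≤ a * (1 / s * ‖x - P‖)) :
    Metric.infDist P D.primalSol ≤ a / √(a ^ 2 + s ^ 2) * Metric.infDist x D.primalSol ∧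
      ‖x - P‖ ≤ Metric.infDist x D.primalSol := by
  set d := Metric.infDist P D.primalSol
  set e := ‖x - P‖
  have hd : 0 ≤ d := Metric.infDist_nonneg
  have he : 0 ≤ e := norm_nonneg _
  have hpyth : √(d ^ 2 + e ^ 2) ≤ Metric.infDist x D.primalSol := by
    refine (Metric.le_infDist hΩ).2 fun xb hxb => Real.sqrt_le_iff.2 ⟨dist_nonneg, ?_⟩
    have h1 : d ≤ ‖P - xb‖ := by
      rw [← dist_eq_norm]
      exact Metric.infDist_le_dist_of_mem hxb
    rw [dist_eq_norm]
    exact (add_le_add_left (pow_le_pow_left₀ hd h1 2) _).trans (hP.sq_add_sq_le hh hp hs hxb)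
  have hsq : 0 < √(a ^ 2 + s ^ 2) := Real.sqrt_pos.2 (by positivity)
  refine ⟨?_, le_trans (Real.le_sqrt_of_sq_le (by nlinarith)) hpyth⟩
  refine le_trans ?_ (mul_le_mul_of_nonneg_left hpyth (by positivity))
  rw [div_mul_eq_mul_div, le_div_iff₀ hsq]
  have h1 : s * d ≤ a * e := by
    have := mul_le_mul_of_nonneg_left hbound hs.le
    have h2 : s * (a * (1 / s * e)) = a * e := by field_simp
    linarith
  refine (sq_le_sq₀ (by positivity) (by positivity)).1 ?_
  rw [mul_pow, mul_pow, Real.sq_sqrt (by positivity), Real.sq_sqrt (by positivity)]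
  have h2 : (s * d) ^ 2 ≤ (a * e) ^ 2 := pow_le_pow_left₀ (by positivity) h1 2
  nlinarith

/-! ### The dual problem and the augmented Lagrangian -/

theorem augLagr_eq (D : Data X Y) (s : ℝ) (w : Dual X Y) (x : X) :
    D.augLagr s w x = D.dualObj w +
      ((s / 2 * ‖D.resid w‖ ^ 2 - inner ℝ x (D.resid w) : ℝ) : EReal) := by
  rw [augLagr, lagr, EReal.coe_sub, sub_eq_add_neg, sub_eq_add_neg, add_assoc,
    add_comm (-((inner ℝ x (D.resid w) : ℝ) : EReal))]

theorem inner_resid (w : Dual X Y) (u : X) :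
    inner ℝ u (D.resid w) = inner ℝ w.fst (D.A u) + inner ℝ w.snd u - inner ℝ D.c u := by
  rw [resid, inner_sub_right, inner_add_right, LinearMap.adjoint_inner_right,
    real_inner_comm u D.c, real_inner_comm w.fst, real_inner_comm w.snd]

/-- The exact minimizer of the augmented Lagrangian at `x` that belongs to the proximal point. -/
noncomputable def proxPair (D : Data X Y) (s : ℝ) (x P : X) : Dual X Y :=
  pair (lossGrad D.h (D.A P)) (D.proxDual s x P)

theorem resid_proxPair : D.resid (D.proxPair s x P) = (1 / s) • (x - P) := by
  simp only [resid, proxPair, pair, proxDual, WithLp.toLp_fst, WithLp.toLp_snd]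
  abel

theorem hConj_proxPair (hh : SmoothLoss D.h α) : D.hConj (D.proxPair s x P).fst =
    ((inner ℝ (D.proxPair s x P).fst (D.A P) - D.h (D.A P) : ℝ) : EReal) :=
  hh.hConj_lossGrad (D.A P)

theorem pConj_proxPair {a : ℝ} (ha : D.p P = a) (hP : D.IsProx s x P) :
    D.pConj (D.proxPair s x P).snd =
      ((inner ℝ (D.proxPair s x P).snd P - a : ℝ) : EReal) :=
  conj_eq_of_mem_subdiff ha hP

/-- The suboptimality of `w` in the minimization of the augmented Lagrangian at `x` controls the
distance of the multiplier update to the proximal point, and the distance of `y` to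
`∇h` at the image of the proximal point. -/
theorem IsProx.sq_le_of_augLagr_sub_le (hh : SmoothLoss D.h α) (hp : ClosedProperConvex D.p)
    (hs : 0 < s) (hP : D.IsProx s x P) {w : Dual X Y} {e : ℝ}
    (hw : D.augLagr s w x - (⨅ v, D.augLagr s v x) ≤ (e : EReal)) :
    1 / (2 * s) * ‖x - s • D.resid w - P‖ ^ 2
      + α / 4 * ‖w.fst - lossGrad D.h (D.A P)‖ ^ 2 ≤ e := by
  obtain ⟨a, ha⟩ := hP.exists_p_eq hp
  have hval : D.augLagr s (D.proxPair s x P) x =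
      ((-(D.h (D.A P) - inner ℝ D.c P + a) - 1 / (2 * s) * ‖x - P‖ ^ 2 : ℝ) : EReal) := by
    rw [augLagr_eq, dualObj_eq_coe (hConj_proxPair hh) (pConj_proxPair ha hP), ← EReal.coe_add]
    congr 1
    have h1 := inner_resid (D := D) (D.proxPair s x P) P
    rw [resid_proxPair] at h1 ⊢
    rw [norm_smul, Real.norm_of_nonneg (by positivity)]
    rw [real_inner_smul_right] at h1 ⊢
    have h2 : inner ℝ x (x - P) = ‖x - P‖ ^ 2 + inner ℝ P (x - P) := by
      rw [← real_inner_self_eq_norm_sq, ← inner_add_left, sub_add_cancel]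
    rw [h2]
    have h3 : s / 2 * (1 / s * ‖x - P‖) ^ 2 - 1 / s * (‖x - P‖ ^ 2 + inner ℝ P (x - P))
        = - (1 / s * inner ℝ P (x - P)) - 1 / (2 * s) * ‖x - P‖ ^ 2 := by
      field_simp
      ring
    linarith
  have hw' := (EReal.sub_le_sub le_rfl ((iInf_le _ (D.proxPair s x P)).trans hval.le)).trans hw
  have htop : D.dualObj w ≠ ⊤ := by
    intro h
    rw [augLagr_eq, h, EReal.top_add_coe, EReal.top_sub_coe, top_le_iff] at hw'
    exact EReal.coe_ne_top _ hw'
  obtain ⟨b₁, b₂, hb₁, hb₂⟩ := exists_coe_of_dualObj_ne_top hp htop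
  rw [augLagr_eq, dualObj_eq_coe hb₁ hb₂, ← EReal.coe_add, ← EReal.coe_sub,
    EReal.coe_le_coe_iff] at hw'
  have h1 := hh.sq_le_conj_gap hb₁ (D.A P)
  have h2 := inner_le_of_conj_eq hb₂ ha
  have h3 := inner_resid (D := D) w P
  have h4 : 1 / (2 * s) * ‖x - s • D.resid w - P‖ ^ 2 = 1 / (2 * s) * ‖x - P‖ ^ 2
      - inner ℝ x (D.resid w) + inner ℝ P (D.resid w) + s / 2 * ‖D.resid w‖ ^ 2 := by
    rw [show x - s • D.resid w - P = (x - P) - s • D.resid w by abel, norm_sub_sq_real,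
      real_inner_smul_right, norm_smul, Real.norm_of_nonneg hs.le, inner_sub_left]
    field_simp
    ring
  linarith

/-- Strong duality, and uniqueness of the dual solution by the strong convexity of `h*`. -/
theorem dualSol_eq (hh : SmoothLoss D.h α) (hp : ClosedProperConvex D.p)
    (hx : x ∈ D.primalSol) : D.dualSol = {D.proxPair 1 x x} := by
  have hP := isProx_self hh hp hx
  obtain ⟨a, ha⟩ := hP.exists_p_eq hp
  have hr : D.resid (D.proxPair 1 x x) = 0 := by simp [resid_proxPair]
  have hval : D.dualObj (D.proxPair 1 x x) =
      ((-(D.h (D.A x) - inner ℝ D.c x + a) : ℝ) : EReal) := by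
    rw [dualObj_eq_coe (hConj_proxPair hh) (pConj_proxPair ha hP)]
    have h1 := inner_resid (D := D) (D.proxPair 1 x x) x
    rw [hr, inner_zero_right] at h1
    congr 1
    linarith
  -- On the feasible set the gap to the value at the proximal pair is at least a multiple of
  -- the squared distance of the first components.
  have hgap : ∀ w : Dual X Y, D.resid w = 0 → ∀ r : ℝ, D.dualObj w ≤ r →
      α / 4 * ‖w.fst - lossGrad D.h (D.A x)‖ ^ 2
        ≤ r + (D.h (D.A x) - inner ℝ D.c x + a) := by
    intro w hw r hle
    obtain ⟨b₁, b₂, hb₁, hb₂⟩ := exists_coe_of_dualObj_ne_top hp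
      (hle.trans_lt (EReal.coe_lt_top r)).ne
    rw [dualObj_eq_coe hb₁ hb₂, EReal.coe_le_coe_iff] at hle
    have h1 := hh.sq_le_conj_gap hb₁ (D.A x)
    have h2 := inner_le_of_conj_eq hb₂ ha
    have h3 := inner_resid (D := D) w x
    rw [hw, inner_zero_right] at h3
    linarith
  have hα := hh.modulus_pos
  ext w
  rw [mem_singleton_iff]
  constructor
  · rintro ⟨hw, hmin⟩
    have h1 := hgap w hw _ ((hmin (a := D.proxPair 1 x x) hr).trans hval.le)
    have h2 : w.fst = lossGrad D.h (D.A x) := by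
      have : ‖w.fst - lossGrad D.h (D.A x)‖ ^ 2 ≤ 0 := by
        by_contra! h
        have : 0 < α / 4 * ‖w.fst - lossGrad D.h (D.A x)‖ ^ 2 := by positivity
        linarith
      exact sub_eq_zero.1 (norm_eq_zero.1 (pow_eq_zero_iff two_ne_zero |>.1
        (le_antisymm this (sq_nonneg _))))
    have h3 : w.snd = D.proxDual 1 x x := by
      rw [resid, h2] at hw
      simp only [proxDual, sub_self, smul_zero, add_zero]
      rw [eq_sub_iff_add_eq, add_comm]
      exact sub_eq_zero.1 hw
    refine WithLp.ofLp_injective 2 (Prod.ext h2 h3)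
  · rintro rfl
    refine ⟨hr, fun w hw => ?_⟩
    change D.dualObj _ ≤ D.dualObj w
    refine le_of_forall_real fun r hle => ?_
    have h1 := hgap w hw r hle
    rw [hval, EReal.coe_le_coe_iff]
    have : 0 ≤ α / 4 * ‖w.fst - lossGrad D.h (D.A x)‖ ^ 2 := by positivity
    linarith

/-! ### The operator of the Lagrangian -/

/-- The zeros of the operator of the Lagrangian have a dual solution as their first part. -/
theorem fst_mem_dualSol_of_zero_mem_Tl (hp : ClosedProperConvex D.p) {w₀ : Dual X Y}
    (hw₀ : D.dualObj w₀ ≠ ⊤) {u : Triple X Y} (hu : 0 ∈ D.Tl u) : u.fst ∈ D.dualSol := by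
  obtain ⟨h1, h2⟩ := hu
  have hmin : ∀ w, D.lagr u.fst u.snd ≤ D.lagr w u.snd := by
    intro w
    simpa using h1 w
  obtain ⟨c₁, c₂, hc₁, hc₂⟩ := exists_coe_of_dualObj_ne_top hp hw₀
  have htop : D.dualObj u.fst ≠ ⊤ := by
    intro h
    have := hmin w₀
    rw [lagr, lagr, h, dualObj_eq_coe hc₁ hc₂, EReal.top_sub_coe, ← EReal.coe_sub,
      top_le_iff] at this
    exact EReal.coe_ne_top _ this
  obtain ⟨b₁, b₂, hb₁, hb₂⟩ := exists_coe_of_dualObj_ne_top hp htop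
  have hr : D.resid u.fst = 0 := by
    have := h2 (u.snd - D.resid u.fst)
    simp only [lagr, dualObj_eq_coe hb₁ hb₂, WithLp.zero_snd, neg_zero, inner_zero_left,
      EReal.coe_zero, add_zero, ← EReal.coe_sub, EReal.coe_le_coe_iff, inner_sub_left,
      real_inner_self_eq_norm_sq] at this
    exact norm_eq_zero.1 (pow_eq_zero_iff two_ne_zero |>.1
      (le_antisymm (by linarith) (sq_nonneg _)))
  refine ⟨hr, fun w hw => ?_⟩
  have := hmin w
  rw [mem_ofPred_eq] at hw
  simpa [lagr, hr, hw] using this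

theorem resid_combo (D : Data X Y) {s t : ℝ} (hst : s + t = 1) (v w : Dual X Y) :
    D.resid (s • v + t • w) = s • D.resid v + t • D.resid w := by
  have hc : D.c = s • D.c + t • D.c := by rw [← add_smul, hst, one_smul]
  simp only [resid, WithLp.add_fst, WithLp.add_snd, WithLp.smul_fst, WithLp.smul_snd, map_add,
    map_smul, smul_sub, smul_add]
  nth_rw 1 [hc]
  abel

theorem differentiable_resid (D : Data X Y) : Differentiable ℝ D.resid := by
  have h1 : Differentiable ℝ fun w : Dual X Y => w.fst :=
    (WithLp.fstL 2 ℝ Y X).differentiable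
  have h2 : Differentiable ℝ fun w : Dual X Y => w.snd :=
    (WithLp.sndL 2 ℝ Y X).differentiable
  exact ((((LinearMap.adjoint D.A).toContinuousLinearMap).differentiable.comp h1).add
    h2).sub_const D.c

theorem lagr_le_coe_iff {w : Dual X Y} {b : ℝ} :
    D.lagr w x ≤ b ↔ D.dualObj w ≤ ((b + inner ℝ x (D.resid w) : ℝ) : EReal) := by
  rw [lagr, EReal.coe_add]
  exact EReal.sub_le_iff_le_add (Or.inl (EReal.coe_ne_bot _)) (Or.inl (EReal.coe_ne_top _))

theorem convex_epigraph_lagr (hp : ClosedProperConvex D.p) (x : X) :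
    Convex ℝ {q : Dual X Y × ℝ | D.lagr q.1 x ≤ (q.2 : EReal)} := by
  rintro ⟨v, b⟩ hv ⟨w, c⟩ hw s t hs ht hst
  change D.lagr v x ≤ (b : EReal) at hv
  change D.lagr w x ≤ (c : EReal) at hw
  change D.lagr (s • v + t • w) x ≤ ((s * b + t * c : ℝ) : EReal)
  rw [lagr_le_coe_iff] at hv hw ⊢
  have h := convex_epigraph_dualObj hp (x := (v, b + inner ℝ x (D.resid v))) hv
    (y := (w, c + inner ℝ x (D.resid w))) hw hs ht hst
  change D.dualObj (s • v + t • w) ≤ ((s * (b + inner ℝ x (D.resid v))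
    + t * (c + inner ℝ x (D.resid w)) : ℝ) : EReal) at h
  refine h.trans (EReal.coe_le_coe_iff.2 (le_of_eq ?_))
  rw [D.resid_combo hst, inner_add_right, real_inner_smul_right, real_inner_smul_right]
  ring

/-- A subgradient of the augmented Lagrangian at `w`, together with the residual of `w`, belongs to
the operator of the Lagrangian at `w` and the updated multiplier: the augmented Lagrangian is the
Lagrangian at the updated multiplier plus a quadratic function that is stationary at `w`. -/
theorem mem_Tl_of_mem_subdiff_augLagr (hp : ClosedProperConvex D.p) {w₀ w v : Dual X Y}
    (hw₀ : D.dualObj w₀ ≠ ⊤) (hv : v ∈ subdiff (fun w => D.augLagr s w x) w) :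
    (WithLp.toLp 2 (v, D.resid w) : Triple X Y)
      ∈ D.Tl (WithLp.toLp 2 (w, x - s • D.resid w)) := by
  have hfin : ∀ u : Dual X Y, D.dualObj u ≠ ⊥ := fun u =>
    EReal.add_ne_bot_iff.2 ⟨D.hConj_ne_bot _, pConj_ne_bot hp _⟩
  have htop : D.dualObj w ≠ ⊤ := by
    intro h
    have h1 := hv w₀
    simp only [augLagr_eq, h, EReal.top_add_coe, top_le_iff] at h1
    exact (EReal.add_lt_top hw₀ (EReal.coe_ne_top _)).ne h1
  obtain ⟨b, hb⟩ : ∃ b : ℝ, D.dualObj w = b := ⟨_, (EReal.coe_toReal htop (hfin w)).symm⟩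
  set xn := x - s • D.resid w with hxn
  refine ⟨?_, fun u => ?_⟩
  · have hsum : ∀ u, D.augLagr s u x = D.lagr u xn +
        ((s / 2 * ‖D.resid u - D.resid w‖ ^ 2 - s / 2 * ‖D.resid w‖ ^ 2 : ℝ) : EReal) := by
      intro u
      rw [augLagr_eq, lagr, sub_eq_add_neg (D.dualObj u), add_assoc, ← EReal.coe_neg,
        ← EReal.coe_add]
      congr 2
      rw [norm_sub_sq_real, hxn, inner_sub_left, real_inner_smul_left,
        real_inner_comm (D.resid u) (D.resid w)]
      ring
    have hd : HasFDerivAt (fun u => s / 2 * ‖D.resid u - D.resid w‖ ^ 2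
        - s / 2 * ‖D.resid w‖ ^ 2) (innerSL ℝ (0 : Dual X Y)) w := by
      have h1 := (((D.differentiable_resid w).hasFDerivAt.sub_const (D.resid w)).norm_sq.const_mul
        (s / 2)).sub_const (s / 2 * ‖D.resid w‖ ^ 2)
      refine h1.congr_fderiv ?_
      ext u
      simp
    simp only [hsum] at hv
    have hl : D.lagr w xn = ((b - inner ℝ xn (D.resid w) : ℝ) : EReal) := by
      rw [lagr, hb, EReal.coe_sub]
    have := sub_mem_subdiff_of_mem_subdiff_add (φ := fun u => D.lagr u xn)
      (convex_epigraph_lagr hp xn) hl hd hv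
    rwa [sub_zero] at this
  · change D.lagr w u ≤ D.lagr w xn + ((inner ℝ (-D.resid w) (u - xn) : ℝ) : EReal)
    rw [lagr, lagr, hb, ← EReal.coe_sub, ← EReal.coe_sub, ← EReal.coe_add, EReal.coe_le_coe_iff,
      inner_neg_left, inner_sub_right, real_inner_comm u, real_inner_comm xn]
    linarith

end Data
/-! ### The rates -/

theorem tendsto_of_le_add_summable {d ε : ℕ → ℝ} (hd : ∀ k, 0 ≤ d k) (hε : ∀ k, 0 ≤ ε k)
    (hsum : Summable ε) (h : ∀ k, d (k + 1) ≤ d k + ε k) : ∃ l, Tendsto d atTop (𝓝 l) := by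
  set S : ℕ → ℝ := fun k => ∑ i ∈ Finset.range k, ε i with hS
  have hanti : Antitone fun k => d k - S k := antitone_nat_of_succ_le fun k => by
    simp only [hS, Finset.sum_range_succ]
    linarith [h k]
  have hbdd : BddBelow (range fun k => d k - S k) := by
    refine ⟨-∑' i, ε i, ?_⟩
    rintro _ ⟨k, rfl⟩
    have := hsum.sum_le_tsum (Finset.range k) fun i _ => hε i
    simp only [hS]
    linarith [hd k]
  have := (tendsto_atTop_ciInf hanti hbdd).add hsum.hasSum.tendsto_sum_nat
  exact ⟨_, by simpa [hS] using this⟩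

/-- The penalty parameters converge in `ℝ` or diverge to infinity, according to `σ_∞`. -/
theorem tendsto_real_of_tendsto_ofReal {σ : ℕ → ℝ} {σinf : ℝ≥0∞} (hpos : ∀ k, 0 < σ k)
    (hmono : Monotone σ) (hlim : Tendsto (fun k => ENNReal.ofReal (σ k)) atTop (𝓝 σinf)) :
    (σinf = ⊤ ∧ Tendsto σ atTop atTop) ∨
      (σinf ≠ ⊤ ∧ 0 < σinf.toReal ∧ Tendsto σ atTop (𝓝 σinf.toReal)) := by
  rcases eq_or_ne σinf ⊤ with h | h
  · rw [h] at hlim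
    exact Or.inl ⟨h, ENNReal.tendsto_ofReal_nhds_top.1 hlim⟩
  · have h1 : Tendsto σ atTop (𝓝 σinf.toReal) :=
      ((ENNReal.tendsto_toReal h).comp hlim).congr fun k => ENNReal.toReal_ofReal (hpos k).le
    exact Or.inr ⟨h, (hpos 0).trans_le (hmono.ge_of_tendsto h1 0), h1⟩

theorem div_sqrt_lt_one {a s : ℝ} (hs : 0 < s) : a / √(a ^ 2 + s ^ 2) < 1 := by
  rw [div_lt_one (Real.sqrt_pos.2 (by positivity))]
  exact Real.lt_sqrt_of_sq_lt (by nlinarith)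

theorem thetaInf_lt_one {σ : ℕ → ℝ} {σinf : ℝ≥0∞} (hpos : ∀ k, 0 < σ k)
    (hmono : Monotone σ) (hlim : Tendsto (fun k => ENNReal.ofReal (σ k)) atTop (𝓝 σinf)) (a : ℝ) :
    thetaInf a σinf < 1 := by
  rcases tendsto_real_of_tendsto_ofReal hpos hmono hlim with ⟨h, -⟩ | ⟨h, hs, -⟩
  · simp [thetaInf, h]
  · simpa [thetaInf, h] using div_sqrt_lt_one hs

theorem tendsto_theta {σ : ℕ → ℝ} {σinf : ℝ≥0∞} (hpos : ∀ k, 0 < σ k) (hmono : Monotone σ)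
    (hlim : Tendsto (fun k => ENNReal.ofReal (σ k)) atTop (𝓝 σinf)) (a : ℝ) {δ : ℕ → ℝ}
    (hδ : Tendsto δ atTop (𝓝 0)) :
    Tendsto (fun k => theta a (σ k) (δ k)) atTop (𝓝 (thetaInf a σinf)) := by
  have h1 : Tendsto (fun k => a / √(a ^ 2 + σ k ^ 2)) atTop (𝓝 (thetaInf a σinf)) := by
    rcases tendsto_real_of_tendsto_ofReal hpos hmono hlim with ⟨h, hs⟩ | ⟨h, hs0, hs⟩
    · simp only [thetaInf, h, if_true]
      refine Tendsto.const_div_atTop (tendsto_atTop_mono (fun k => ?_) hs) a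
      exact Real.le_sqrt_of_sq_le (by nlinarith [sq_nonneg a])
    · simp only [thetaInf, h, if_false]
      refine tendsto_const_nhds.div (((hs.pow 2).const_add _).sqrt) ?_
      exact (Real.sqrt_pos.2 (by positivity)).ne'
  have h2 := (h1.add (hδ.const_mul 2)).div (hδ.const_sub 1) (by norm_num)
  rw [mul_zero, add_zero, sub_zero, div_one] at h2
  exact h2

theorem tendsto_theta' {σ : ℕ → ℝ} {σinf : ℝ≥0∞} (hpos : ∀ k, 0 < σ k) (hmono : Monotone σ)
    (hlim : Tendsto (fun k => ENNReal.ofReal (σ k)) atTop (𝓝 σinf)) (a : ℝ) {δ : ℕ → ℝ}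
    (hδ : Tendsto δ atTop (𝓝 0)) :
    Tendsto (fun k => theta' a (σ k) (δ k)) atTop (𝓝 (thetaInf' a σinf)) := by
  have h1 : Tendsto (fun k => a * (1 + δ k)) atTop (𝓝 a) := by
    simpa using (hδ.const_add 1).const_mul a
  rcases tendsto_real_of_tendsto_ofReal hpos hmono hlim with ⟨h, hs⟩ | ⟨h, hs0, hs⟩
  · simpa [thetaInf', h, theta'] using h1.div_atTop hs
  · simp only [thetaInf', h, if_false]
    exact h1.div hs hs0.ne'

/-- The effect of a relative error `δ` in a step that contracts the distance to a set from `dx` to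
`dP`: `q` is the length of the exact step, `e` that of the inexact one, `r ≤ δ e` the distance
between their end points, and `dx'` the distance to the set after the inexact step. -/
theorem le_theta_mul {a s δ dx dP dx' e q r : ℝ} (hδ : 0 ≤ δ) (hδ1 : δ < 1)
    (hdx : 0 ≤ dx) (hP : dP ≤ a / √(a ^ 2 + s ^ 2) * dx) (ha : 0 ≤ a) (hq : q ≤ dx) (hr : r ≤ δ * e)
    (he : e ≤ r + q) (hx' : dx' ≤ r + dP) : dx' ≤ theta a s δ * dx := by
  have h1 : 0 < 1 - δ := by linarith
  set μ := a / √(a ^ 2 + s ^ 2)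
  have hμ : 0 ≤ μ := by positivity
  rw [theta, div_mul_eq_mul_div, le_div_iff₀ h1]
  have h2 : (1 - δ) * e ≤ dx := by linarith
  have h3 : r * (1 - δ) ≤ δ * dx := by nlinarith
  nlinarith [mul_nonneg hδ hdx, mul_nonneg hδ (mul_nonneg hμ hdx)]

theorem norm_toLp_le_add {E F : Type*} [SeminormedAddCommGroup E] [SeminormedAddCommGroup F]
    (w : E) (x : F) : ‖(WithLp.toLp 2 (w, x) : WithLp 2 (E × F))‖ ≤ ‖w‖ + ‖x‖ := by
  refine (sq_le_sq₀ (norm_nonneg _) (by positivity)).1 ?_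
  rw [WithLp.prod_norm_sq_eq_of_L2]
  change ‖w‖ ^ 2 + ‖x‖ ^ 2 ≤ _
  nlinarith [mul_nonneg (norm_nonneg w) (norm_nonneg x)]

namespace Data

variable {X Y : Type*} [NormedAddCommGroup X] [InnerProductSpace ℝ X] [FiniteDimensional ℝ X]
  [NormedAddCommGroup Y] [InnerProductSpace ℝ Y] [FiniteDimensional ℝ Y]
variable {D : Data X Y} {α : ℝ}

/-! ### Convergence of the inexact proximal point method -/

/-- A sequence that follows the proximal steps up to summable errors has vanishing proximal
residuals and converges to a primal solution. -/
theorem tendsto_of_isProx (hh : SmoothLoss D.h α) (hp : ClosedProperConvex D.p)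
    (hΩ : D.primalSol.Nonempty) {σ ε : ℕ → ℝ} {x P : ℕ → X} (hpos : ∀ k, 0 < σ k)
    (hmono : Monotone σ) (hε : ∀ k, 0 ≤ ε k) (hsum : Summable ε)
    (hP : ∀ k, D.IsProx (σ k) (x k) (P k)) (herr : ∀ k, ‖x (k + 1) - P k‖ ≤ ε k) :
    ∃ xs ∈ D.primalSol, Tendsto x atTop (𝓝 xs) ∧
      Tendsto (fun k => ‖x k - P k‖) atTop (𝓝 0) := by
  have hε0 := hsum.tendsto_atTop_zero
  have hstep : ∀ xb ∈ D.primalSol, ∀ k, ‖x (k + 1) - xb‖ ≤ ‖P k - xb‖ + ε k := fun xb _ k => by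
    have := norm_add_le (x (k + 1) - P k) (P k - xb)
    rw [sub_add_sub_cancel] at this
    linarith [herr k]
  have hconv : ∀ xb ∈ D.primalSol, ∃ l, Tendsto (fun k => ‖x k - xb‖) atTop (𝓝 l) :=
    fun xb hxb => tendsto_of_le_add_summable (fun _ => norm_nonneg _) hε hsum fun k =>
      (hstep xb hxb k).trans (by linarith [(hP k).norm_sub_le hh hp (hpos k) hxb])
  obtain ⟨xb, hxb⟩ := hΩ
  obtain ⟨l, hl⟩ := hconv xb hxb
  have hPl : Tendsto (fun k => ‖P k - xb‖) atTop (𝓝 l) := by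
    have h1 := ((tendsto_add_atTop_iff_nat 1).2 hl).sub hε0
    rw [sub_zero] at h1
    exact tendsto_of_tendsto_of_tendsto_of_le_of_le h1 hl
      (fun k => by linarith [hstep xb hxb k]) fun k => (hP k).norm_sub_le hh hp (hpos k) hxb
  have hres : Tendsto (fun k => ‖x k - P k‖) atTop (𝓝 0) := by
    have h1 : Tendsto (fun k => ‖x k - P k‖ ^ 2) atTop (𝓝 0) := by
      have h2 := (hl.pow 2).sub (hPl.pow 2)
      rw [sub_self] at h2
      exact squeeze_zero (fun _ => sq_nonneg _)
        (fun k => by linarith [(hP k).sq_add_sq_le hh hp (hpos k) hxb]) h2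
    have h3 := h1.sqrt
    simpa [Real.sqrt_sq (norm_nonneg _)] using h3
  have : ProperSpace X := FiniteDimensional.proper ℝ X
  obtain ⟨R, hR⟩ := hl.bddAbove_range
  obtain ⟨xs, -, φ, hφ, hxs⟩ := tendsto_subseq_of_bounded
    (Metric.isBounded_closedBall (x := xb) (r := R)) (x := x) fun k => by
      rw [Metric.mem_closedBall, dist_eq_norm]
      exact hR ⟨k, rfl⟩
  obtain ⟨m, hm⟩ := exists_f_eq_of_mem_primalSol hp hxb
  have hPs : Tendsto (P ∘ φ) atTop (𝓝 xs) := by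
    have h1 : Tendsto (fun k => x k - P k) atTop (𝓝 0) := tendsto_zero_iff_norm_tendsto_zero.2 hres
    have h2 := hxs.sub (h1.comp hφ.tendsto_atTop)
    rw [sub_zero] at h2
    exact h2.congr fun k => by simp
  -- The subgradient inequality at the proximal points makes their values tend to the minimum.
  have hval : ∀ k, D.f (P k) ≤
      ((m + 1 / σ 0 * ‖x k - P k‖ * ‖P k - xb‖ : ℝ) : EReal) := fun k => by
    obtain ⟨a, ha⟩ := (hP k).exists_p_eq hp
    have h1 := (mem_subdiff_iff (f_eq_coe ha)).1 ((hP k).mem_Tf hh hp) xb m hm.le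
    rw [f_eq_coe ha, EReal.coe_le_coe_iff]
    have h2 := real_inner_le_norm ((1 / σ k) • (x k - P k)) (P k - xb)
    rw [norm_smul, Real.norm_of_nonneg (one_div_pos.2 (hpos k)).le] at h2
    have h3 : 1 / σ k ≤ 1 / σ 0 := one_div_le_one_div_of_le (hpos 0) (hmono (Nat.zero_le k))
    have h4 : 1 / σ k * ‖x k - P k‖ * ‖P k - xb‖ ≤ 1 / σ 0 * ‖x k - P k‖ * ‖P k - xb‖ := by
      gcongr
    rw [← neg_sub (P k) xb, inner_neg_right] at h1
    linarith
  have hlim : Tendsto (fun k => m + 1 / σ 0 * ‖x k - P k‖ * ‖P k - xb‖) atTop (𝓝 m) := by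
    simpa using ((hres.const_mul (1 / σ 0)).mul hPl).const_add m
  have hxsΩ : xs ∈ D.primalSol := by
    refine mem_primalSol_iff.2 fun u => le_trans ?_ (mem_primalSol_iff.1 hxb u)
    rw [hm]
    by_contra! h
    obtain ⟨r, hr1, hr2⟩ := EReal.lt_iff_exists_real_btwn.1 h
    have h1 := hPs.eventually (lowerSemicontinuous_f hh hp xs r hr2)
    have h2 := (hlim.comp hφ.tendsto_atTop).eventually_lt_const (EReal.coe_lt_coe_iff.1 hr1)
    obtain ⟨k, hk1, hk2⟩ := (h1.and h2).exists
    exact absurd (hk1.trans_le (hval (φ k))) (not_lt.2 (by exact_mod_cast hk2.le))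
  refine ⟨xs, hxsΩ, ?_, hres⟩
  obtain ⟨l', hl'⟩ := hconv xs hxsΩ
  have h0 : Tendsto (fun k => ‖x (φ k) - xs‖) atTop (𝓝 0) :=
    tendsto_iff_norm_sub_tendsto_zero.1 hxs
  rw [tendsto_nhds_unique (hl'.comp hφ.tendsto_atTop) h0] at hl'
  exact tendsto_iff_norm_sub_tendsto_zero.2 hl'

/-- The linear rate of the primal iterates. -/
theorem eventually_infDist_le (hh : SmoothLoss D.h α) (hp : ClosedProperConvex D.p)
    (hΩ : D.primalSol.Nonempty) {a : ℝ} (hTf : ErrorBound D.Tf 0 a) {σ δ : ℕ → ℝ} {x P : ℕ → X}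
    (hpos : ∀ k, 0 < σ k) (hmono : Monotone σ) (hδ : ∀ k, 0 ≤ δ k)
    (hδ0 : Tendsto δ atTop (𝓝 0))
    (hP : ∀ k, D.IsProx (σ k) (x k) (P k))
    (hres : Tendsto (fun k => ‖x k - P k‖) atTop (𝓝 0))
    (herr : ∀ k, ‖x (k + 1) - P k‖ ≤ δ k * ‖x (k + 1) - x k‖) :
    ∀ᶠ k in atTop, Metric.infDist (x (k + 1)) D.primalSol ≤
        theta a (σ k) (δ k) * Metric.infDist (x k) D.primalSol := by
  obtain ⟨ha, -, η, hη, hbound⟩ := hTf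
  rw [inv_Tf_zero] at hbound
  have h1 : Tendsto (fun k => 1 / σ 0 * ‖x k - P k‖) atTop (𝓝 0) := by
    simpa using hres.const_mul (1 / σ 0)
  filter_upwards [h1.eventually_le_const hη, hδ0.eventually_lt_const zero_lt_one] with k hk hδ1
  have hv := (hP k).mem_Tf hh hp
  have hdist : Metric.infDist 0 (D.Tf (P k)) ≤ 1 / σ k * ‖x k - P k‖ := by
    refine (Metric.infDist_le_dist_of_mem hv).trans (le_of_eq ?_)
    rw [dist_zero_left, norm_smul, Real.norm_of_nonneg (one_div_pos.2 (hpos k)).le]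
  have hmon : 1 / σ k * ‖x k - P k‖ ≤ 1 / σ 0 * ‖x k - P k‖ :=
    mul_le_mul_of_nonneg_right (one_div_le_one_div_of_le (hpos 0) (hmono (Nat.zero_le k)))
      (norm_nonneg _)
  have hb := (hbound (P k) ⟨_, hv⟩ (hdist.trans (hmon.trans hk))).trans
    (mul_le_mul_of_nonneg_left hdist ha)
  obtain ⟨h2, h3⟩ := (hP k).infDist_le hh hp (hpos k) hΩ ha hb
  refine le_theta_mul (hδ k) hδ1 Metric.infDist_nonneg h2 ha h3 (herr k) ?_ ?_
  · have := norm_sub_le_norm_sub_add_norm_sub (x (k + 1)) (P k) (x k)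
    rwa [norm_sub_rev (P k)] at this
  · rw [← dist_eq_norm]
    exact Metric.infDist_le_infDist_add_dist.trans_eq (add_comm _ _)

/-! ### Convergence of the dual iterates -/

theorem norm_sub_le_infDist_inv_Tl (hp : ClosedProperConvex D.p) {ws : Dual X Y}
    (hsol : D.dualSol = {ws}) (hws : D.dualObj ws ≠ ⊤) (hne : (inv D.Tl 0).Nonempty)
    (w : Dual X Y) (x : X) :
    ‖w - ws‖ ≤ Metric.infDist (WithLp.toLp 2 (w, x) : Triple X Y) (inv D.Tl 0) := by
  refine (Metric.le_infDist hne).2 fun u hu => ?_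
  have hmem : u.fst ∈ D.dualSol := fst_mem_dualSol_of_zero_mem_Tl hp hws hu
  rw [hsol, mem_singleton_iff] at hmem
  have h1 : ‖w - u.fst‖ ≤ ‖(WithLp.toLp 2 (w, x) : Triple X Y) - u‖ := by
    refine (sq_le_sq₀ (norm_nonneg _) (norm_nonneg _)).1 ?_
    rw [WithLp.prod_norm_sq_eq_of_L2 ((WithLp.toLp 2 (w, x) : Triple X Y) - u)]
    exact le_add_of_nonneg_right (sq_nonneg _)
  rwa [hmem, ← dist_eq_norm (WithLp.toLp 2 (w, x) : Triple X Y)] at h1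

/-- One step of the dual rate: by subregularity the dual iterate `w` is as close to the zeros of
the operator of the Lagrangian as the subgradients and the residual are small. -/
theorem norm_sub_le_of_subregular (hp : ClosedProperConvex D.p) {ws : Dual X Y}
    (hsol : D.dualSol = {ws}) (hws : D.dualObj ws ≠ ⊤) (hne : (inv D.Tl 0).Nonempty)
    {V : Set (Triple X Y)} {ρ a s d : ℝ} (hρ : 0 < ρ) (hρV : Metric.ball 0 ρ ⊆ V) (ha : 0 ≤ a)
    (hs : 0 < s) {w : Dual X Y} {x xn : X} (hxn : xn = x - s • D.resid w)
    (hreg : (D.Tl (WithLp.toLp 2 (w, xn)) ∩ V).Nonempty →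
      Metric.infDist (WithLp.toLp 2 (w, xn) : Triple X Y) (inv D.Tl 0)
        ≤ a * Metric.infDist 0 (D.Tl (WithLp.toLp 2 (w, xn)) ∩ V))
    (hsub : (subdiff (fun w => D.augLagr s w x) w).Nonempty)
    (hdist : Metric.infDist 0 (subdiff (fun w => D.augLagr s w x) w) ≤ d / s * ‖xn - x‖)
    (hsmall : (1 + d) * (1 / s * ‖xn - x‖) < ρ / 2) :
    ‖w - ws‖ ≤ a * ((1 + d) * (1 / s * ‖xn - x‖)) := by
  have hr : ‖D.resid w‖ = 1 / s * ‖xn - x‖ := by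
    have h1 : xn - x = -(s • D.resid w) := by
      rw [hxn]
      abel
    rw [h1, norm_neg, norm_smul, Real.norm_of_nonneg hs.le]
    field_simp
  generalize ‖xn - x‖ = e at *
  -- The distance to the subdifferential is approached up to an arbitrary `η > 0`.
  have hbound : ∀ η ∈ Ioo 0 (ρ / 2), ‖w - ws‖ ≤ a * ((1 + d) * (1 / s * e) + η) := by
    intro η hη
    obtain ⟨v, hv, hvlt⟩ := (Metric.infDist_lt_iff hsub).1
      (hdist.trans_lt (lt_add_of_pos_right _ hη.1))
    rw [dist_zero_left] at hvlt
    have htT := mem_Tl_of_mem_subdiff_augLagr hp hws hv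
    rw [← hxn] at htT
    have hnorm := norm_toLp_le_add v (D.resid w)
    generalize (WithLp.toLp 2 (v, D.resid w) : Triple X Y) = t at *
    have hnorm' : ‖t‖ ≤ (1 + d) * (1 / s * e) + η := by
      have h2 : d / s * e = d * (1 / s * e) := by ring
      linarith
    have htV : t ∈ V := hρV (by
      rw [Metric.mem_ball, dist_zero_right]
      linarith [hη.2])
    have hmem : t ∈ D.Tl (WithLp.toLp 2 (w, xn)) ∩ V := ⟨htT, htV⟩
    have h2 := Metric.infDist_le_dist_of_mem (x := (0 : Triple X Y)) hmem
    rw [dist_zero_left] at h2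
    exact (norm_sub_le_infDist_inv_Tl hp hsol hws hne w xn).trans
      ((hreg ⟨t, hmem⟩).trans (mul_le_mul_of_nonneg_left (h2.trans hnorm') ha))
  have hc : Tendsto (fun η : ℝ => a * ((1 + d) * (1 / s * e) + η)) (𝓝[>] 0)
      (𝓝 (a * ((1 + d) * (1 / s * e) + 0))) :=
    (Continuous.tendsto (by fun_prop) 0).mono_left nhdsWithin_le_nhds
  rw [add_zero] at hc
  refine ge_of_tendsto hc ?_
  filter_upwards [Ioo_mem_nhdsGT (half_pos hρ)] with η hη using hbound η hη

/-- The rate of the dual iterates. -/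
theorem eventually_norm_sub_le (hp : ClosedProperConvex D.p) {σ δ' : ℕ → ℝ} {σinf : ℝ≥0∞}
    {y : ℕ → Y} {z x : ℕ → X} (hseq : D.IsALMSequence σ σinf y z x) {xs : X} {ws : Dual X Y}
    (hx : Tendsto x atTop (𝓝 xs)) (hw : Tendsto (fun k => pair (y k) (z k)) atTop (𝓝 ws))
    (hsol : D.dualSol = {ws}) (hws : D.dualObj ws ≠ ⊤) {a : ℝ}
    (hTl : MetricallySubregular D.Tl (WithLp.toLp 2 (ws, xs)) 0 a)
    (hB2 : D.CritB2 σ y z x δ') :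
    ∀ᶠ k in atTop, ‖pair (y (k + 1)) (z (k + 1)) - ws‖ ≤
        theta' a (σ k) (δ' k) * ‖x (k + 1) - x k‖ := by
  obtain ⟨ha, hzero, U, hU, V, hV, hreg⟩ := hTl
  obtain ⟨hδ, hδ0, hsub⟩ := hB2
  obtain ⟨ρ, hρ, hρV⟩ := Metric.mem_nhds_iff.1 hV
  have hx1 := (tendsto_add_atTop_iff_nat 1).2 hx
  have hw1 := (tendsto_add_atTop_iff_nat 1).2 hw
  have hpairlim : Tendsto (fun k => (WithLp.toLp 2 (pair (y (k + 1)) (z (k + 1)), x (k + 1)) :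
      Triple X Y)) atTop (𝓝 (WithLp.toLp 2 (ws, xs))) :=
    ((WithLp.prod_continuous_toLp 2 _ _).tendsto _).comp (hw1.prodMk_nhds hx1)
  have hsmall : Tendsto (fun k => (1 + δ' k) * (1 / σ 0 * ‖x (k + 1) - x k‖)) atTop (𝓝 0) := by
    simpa using (hδ0.const_add 1).mul ((hx1.sub hx).norm.const_mul (1 / σ 0))
  filter_upwards [hpairlim.eventually hU, hsmall.eventually_lt_const (half_pos hρ)] with k hkU hkρ
  have hbig : (1 + δ' k) * (1 / σ k * ‖x (k + 1) - x k‖)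
      ≤ (1 + δ' k) * (1 / σ 0 * ‖x (k + 1) - x k‖) := by
    have h1 := hδ k
    have h2 : 1 / σ k ≤ 1 / σ 0 :=
      one_div_le_one_div_of_le (hseq.pos 0) (hseq.mono (Nat.zero_le k))
    gcongr
  have h1 := norm_sub_le_of_subregular hp hsol hws ⟨_, hzero⟩ hρ hρV ha (hseq.pos k)
    (hseq.update k) (hreg _ hkU) (hsub k).1 (hsub k).2 (hbig.trans_lt hkρ)
  refine h1.trans (le_of_eq ?_)
  rw [theta']
  ring

/-- The dual iterates converge: the gap controls the distance of `y` to the gradient at the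
image of the proximal point, and `z` follows from the vanishing residual of the constraint. -/
theorem tendsto_dual (hh : SmoothLoss D.h α) {σ ε : ℕ → ℝ} {σinf : ℝ≥0∞} {y : ℕ → Y}
    {z x P : ℕ → X} (hseq : D.IsALMSequence σ σinf y z x) {xs : X}
    (hx : Tendsto x atTop (𝓝 xs)) (hres : Tendsto (fun k => ‖x k - P k‖) atTop (𝓝 0))
    (hε0 : Tendsto ε atTop (𝓝 0))
    (hgap : ∀ k, α / 4 * ‖y (k + 1) - lossGrad D.h (D.A (P k))‖ ^ 2 ≤ ε k ^ 2 / (2 * σ k)) :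
    Tendsto y atTop (𝓝 (lossGrad D.h (D.A xs))) ∧
      Tendsto z atTop (𝓝 (D.proxDual 1 xs xs)) := by
  have hα := hh.modulus_pos
  have hPs : Tendsto P atTop (𝓝 xs) := by
    have h2 := hx.sub (tendsto_zero_iff_norm_tendsto_zero.2 hres)
    rw [sub_zero] at h2
    exact h2.congr fun k => by simp
  have hA : Continuous D.A := D.A.continuous_of_finiteDimensional
  have hB : Continuous (LinearMap.adjoint D.A) :=
    (LinearMap.adjoint D.A).continuous_of_finiteDimensional
  have hg : Tendsto (fun k => lossGrad D.h (D.A (P k))) atTop (𝓝 (lossGrad D.h (D.A xs))) :=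
    ((hh.continuous_lossGrad.comp hA).tendsto xs).comp hPs
  have hsq : Tendsto (fun k => ‖y (k + 1) - lossGrad D.h (D.A (P k))‖ ^ 2) atTop (𝓝 0) := by
    have h1 : Tendsto (fun k => 4 / α * (ε k ^ 2 / (2 * σ 0))) atTop (𝓝 0) := by
      simpa using ((hε0.pow 2).div_const (2 * σ 0)).const_mul (4 / α)
    refine squeeze_zero (fun _ => sq_nonneg _) (fun k => ?_) h1
    have h2 : ε k ^ 2 / (2 * σ k) ≤ ε k ^ 2 / (2 * σ 0) := by
      have := hseq.pos 0
      have := hseq.mono (Nat.zero_le k)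
      gcongr
    have h3 := mul_le_mul_of_nonneg_left ((hgap k).trans h2) (by positivity : 0 ≤ 4 / α)
    rwa [← mul_assoc, show 4 / α * (α / 4) = 1 by field_simp, one_mul] at h3
  have hy1 : Tendsto (fun k => y (k + 1)) atTop (𝓝 (lossGrad D.h (D.A xs))) := by
    have h1 : Tendsto (fun k => ‖y (k + 1) - lossGrad D.h (D.A (P k))‖) atTop (𝓝 0) := by
      simpa [Real.sqrt_sq (norm_nonneg _)] using hsq.sqrt
    have h2 := (tendsto_zero_iff_norm_tendsto_zero.2 h1).add hg
    simpa using h2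
  refine ⟨(tendsto_add_atTop_iff_nat 1).1 hy1, (tendsto_add_atTop_iff_nat 1).1 ?_⟩
  have hr : Tendsto (fun k => D.resid (pair (y (k + 1)) (z (k + 1)))) atTop (𝓝 0) := by
    rw [tendsto_zero_iff_norm_tendsto_zero]
    have h1 : Tendsto (fun k => 1 / σ 0 * ‖x (k + 1) - x k‖) atTop (𝓝 0) := by
      simpa using (((tendsto_add_atTop_iff_nat 1).2 hx).sub hx).norm.const_mul (1 / σ 0)
    refine squeeze_zero (fun _ => norm_nonneg _) (fun k => ?_) h1
    have h0 := hseq.pos 0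
    have h2 : x (k + 1) - x k = -(σ k • D.resid (pair (y (k + 1)) (z (k + 1)))) := by
      rw [hseq.update k]
      abel
    rw [h2, norm_neg, norm_smul, Real.norm_of_nonneg (hseq.pos k).le, one_div,
      le_inv_mul_iff₀ h0]
    exact mul_le_mul_of_nonneg_right (hseq.mono (Nat.zero_le k)) (norm_nonneg _)
  have h1 := (hr.sub ((hB.tendsto _).comp hy1)).add_const D.c
  have h2 : D.proxDual 1 xs xs = 0 - LinearMap.adjoint D.A (lossGrad D.h (D.A xs)) + D.c := by
    simp only [proxDual, sub_self, smul_zero]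
    abel
  rw [h2]
  refine h1.congr fun k => ?_
  simp only [resid, pair, Function.comp_apply, WithLp.toLp_fst, WithLp.toLp_snd]
  abel

end Data

end Ssnal

theorem mainTheorem3 {X Y : Type*}
    [NormedAddCommGroup X] [InnerProductSpace ℝ X] [FiniteDimensional ℝ X]
    [NormedAddCommGroup Y] [InnerProductSpace ℝ Y] [FiniteDimensional ℝ Y]
    (D : Ssnal.Data X Y) (α : ℝ) (hh : Ssnal.SmoothLoss D.h α)
    (hp : Ssnal.ClosedProperConvex D.p) (hΩ : D.primalSol.Nonempty)
    (a_f : ℝ) (hTf : Ssnal.ErrorBound D.Tf 0 a_f)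
    (σ : ℕ → ℝ) (σinf : ℝ≥0∞) (y : ℕ → Y) (z x : ℕ → X)
    (hseq : D.IsALMSequence σ σinf y z x)
    (ε δ : ℕ → ℝ) (hA : D.CritA σ y z x ε) (hB1 : D.CritB1 σ y z x δ) :
    ∃ (xs : X) (ys : Y) (zs : X),
      (xs ∈ D.primalSol ∧ Tendsto x atTop (𝓝 xs)) ∧
      (∀ᶠ k in atTop, Metric.infDist (x (k + 1)) D.primalSol ≤
        Ssnal.theta a_f (σ k) (δ k) * Metric.infDist (x k) D.primalSol) ∧
      Tendsto (fun k => Ssnal.theta a_f (σ k) (δ k)) atTop (𝓝 (Ssnal.thetaInf a_f σinf)) ∧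
      Ssnal.thetaInf a_f σinf < 1 ∧
      D.dualSol = {Ssnal.pair ys zs} ∧
      ys ∈ interior (Ssnal.dom D.hConj) ∧ zs ∈ Ssnal.dom D.pConj ∧
      Tendsto y atTop (𝓝 ys) ∧ Tendsto z atTop (𝓝 zs) ∧
      ∀ (a_l : ℝ) (δ' : ℕ → ℝ),
        Ssnal.MetricallySubregular D.Tl (Ssnal.triple ys zs xs) 0 a_l →
        D.CritB2 σ y z x δ' →
        (∀ᶠ k in atTop,
          ‖Ssnal.pair (y (k + 1)) (z (k + 1)) - Ssnal.pair ys zs‖ ≤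
            Ssnal.theta' a_l (σ k) (δ' k) * ‖x (k + 1) - x k‖) ∧
        Tendsto (fun k => Ssnal.theta' a_l (σ k) (δ' k)) atTop
          (𝓝 (Ssnal.thetaInf' a_l σinf)) := by
  obtain ⟨hε, hεsum, hA⟩ := hA
  obtain ⟨hδ, hδsum, hB1⟩ := hB1
  have hpos := hseq.pos
  have hα := hh.modulus_pos
  choose P hP using fun k => Ssnal.Data.exists_isProx hh hp hΩ (hpos k) (x k)
  -- Both criteria bound the distance of the next iterate to the proximal point.
  have hgap : ∀ k e, D.Psi σ x k (Ssnal.pair (y (k + 1)) (z (k + 1))) - (⨅ w, D.Psi σ x k w) ≤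
      ((e ^ 2 / (2 * σ k) : ℝ) : EReal) → 0 ≤ e → ‖x (k + 1) - P k‖ ≤ e ∧
        α / 4 * ‖y (k + 1) - Ssnal.lossGrad D.h (D.A (P k))‖ ^ 2 ≤ e ^ 2 / (2 * σ k) := by
    intro k e h he
    have hs := hpos k
    have h1 := (hP k).sq_le_of_augLagr_sub_le hh hp hs h
    rw [← hseq.update k] at h1
    change _ + α / 4 * ‖y (k + 1) - Ssnal.lossGrad D.h (D.A (P k))‖ ^ 2 ≤ _ at h1
    have h2 : 0 ≤ 1 / (2 * σ k) * ‖x (k + 1) - P k‖ ^ 2 := by positivity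
    have h3 : 0 ≤ α / 4 * ‖y (k + 1) - Ssnal.lossGrad D.h (D.A (P k))‖ ^ 2 := by positivity
    refine ⟨(sq_le_sq₀ (norm_nonneg _) he).1 ?_, by linarith⟩
    have h4 : 1 / (2 * σ k) * ‖x (k + 1) - P k‖ ^ 2 ≤ 1 / (2 * σ k) * e ^ 2 := by
      rw [one_div_mul_eq_div _ (e ^ 2)]
      linarith
    exact le_of_mul_le_mul_left h4 (by positivity)
  have hgapA := fun k => hgap k (ε k) (hA k) (hε k)
  have hgapB : ∀ k, ‖x (k + 1) - P k‖ ≤ δ k * ‖x (k + 1) - x k‖ := fun k =>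
    (hgap k _ (by
      rw [mul_pow, ← div_mul_eq_mul_div]
      exact hB1 k) (mul_nonneg (hδ k) (norm_nonneg _))).1
  have hδ0 := hδsum.tendsto_atTop_zero
  obtain ⟨xs, hxs, hx, hres⟩ := Ssnal.Data.tendsto_of_isProx hh hp hΩ hpos hseq.mono hε hεsum hP
    fun k => (hgapA k).1
  obtain ⟨hy, hz⟩ := Ssnal.Data.tendsto_dual hh hseq hx hres hεsum.tendsto_atTop_zero
    fun k => (hgapA k).2
  have hself := Ssnal.Data.isProx_self hh hp hxs
  obtain ⟨a, ha⟩ := hself.exists_p_eq hp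
  have hpc := Ssnal.Data.pConj_proxPair ha hself
  have hsol := Ssnal.Data.dualSol_eq hh hp hxs
  refine ⟨xs, Ssnal.lossGrad D.h (D.A xs), D.proxDual 1 xs xs, ⟨hxs, hx⟩,
    Ssnal.Data.eventually_infDist_le hh hp hΩ hTf hpos hseq.mono hδ hδ0 hP hres hgapB,
    Ssnal.tendsto_theta hpos hseq.mono hseq.lim a_f hδ0,
    Ssnal.thetaInf_lt_one hpos hseq.mono hseq.lim a_f, hsol,
    hh.lossGrad_mem_interior_dom (D.A xs), hpc.trans_lt (EReal.coe_lt_top _), hy, hz,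
    fun a_l δ' hTl hB2 => ⟨?_, Ssnal.tendsto_theta' hpos hseq.mono hseq.lim a_l hB2.2.1⟩⟩
  refine Ssnal.Data.eventually_norm_sub_le hp hseq hx ?_ hsol ?_ hTl hB2
  · exact ((WithLp.prod_continuous_toLp 2 _ _).tendsto _).comp (hy.prodMk_nhds hz)
  · rw [Ssnal.Data.dualObj_eq_coe (Ssnal.Data.hConj_proxPair hh) hpc]
    exact EReal.coe_ne_top _
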